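/- An \emph{admissible sequence} is a nonincreasing sequence $w=(w_i)_{i\ge 1}$ of nonnegative real numbers with $w_1=1$, $\lim_i w_i=0$ and $\sum_i w_i=\infty$. For such $w$ put $W(n)=\sum_{i=1}^n w_i$, and let $d_*(w,1)$ (the predual of the Lorentz sequence space $d(w,1)$) be the complex Banach space of all bounded complex sequences $x$ such that $\lim_{n\to\infty}\frac{1}{W(n)}\sum_{i=1}^n x^*(i)=0$, with the norm $\|x\|_W=\sup_{n\ge 1}\frac{1}{W(n)}\sum_{i=1}^n x^*(i)$, where $x^*=(x^*(i))_i$ is the decreasing rearrangement of $(|x(i)|)_i$. For a complex Banach space $X$ with closed unit ball $B_X$, let $\mathcal{A}_u(X)$ be the space of all functions $f\colon B_X\to\mathbb{C}$ that are uniformly continuous on $B_X$ and holomorphic in the open unit ball, with the norm $\|f\|=\sup_{\|x\|\le 1}|f(x)|$. For $0<s\le 1$ put $\|f\|_s=\sup\{|f(x)|:\|x\|\le s\}$, and say that $f$ attains its $\|\cdot\|_s$-norm if $|f(x_0)|=\|f\|_s$ for some $x_0$ with $\|x_0\|\le s$. Let $w$ be an admissible sequence and let $0<s<1$. Then the set of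 functions in $\mathcal{A}_u(d_*(w,1))$ that attain their $\|\cdot\|_s$-norm is $\|\cdot\|$-dense in $\mathcal{A}_u(d_*(w,1))$ if and only if $w\notin\ell_N$ for every integer $N\ge 1$. -/

import Mathlib

open scoped BoundedContinuousFunction ENNReal

noncomputable section

/-- An admissible sequence: a decreasing (nonincreasing) null sequence of nonnegative reals with
first term `1` and divergent sum. Sequences are indexed from `0`. -/
structure AdmissibleSeq where
  toFun : ℕ → ℝ
  nonneg : ∀ i, 0 ≤ toFun i
  antitone : Antitone toFun
  first : toFun 0 = 1
  tendsto_zero : Filter.Tendsto toFun Filter.atTop (nhds 0)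
  not_summable : ¬ Summable toFun

instance : CoeFun AdmissibleSeq (fun _ => ℕ → ℝ) := ⟨AdmissibleSeq.toFun⟩

/-- The partial sum `w 0 + ⋯ + w (n - 1)` of the first `n` terms. -/
def AdmissibleSeq.partialSum (w : AdmissibleSeq) (n : ℕ) : ℝ := ∑ i ∈ Finset.range n, w i

/-- The decreasing rearrangement of a bounded sequence:
`x* n = inf {t ≥ 0 : at most n indices j satisfy |x j| > t}`, for `n = 0, 1, 2, …`. -/
def decreasingRearrangement (x : ℕ → ℂ) (n : ℕ) : ℝ :=
  sInf {t : ℝ | 0 ≤ t ∧ {j : ℕ | t < ‖x j‖}.encard ≤ n}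

/-- The sum `x* 0 + ⋯ + x* (n - 1)` of the first `n` terms of the decreasing rearrangement. -/
def rearrangedSum (x : ℕ → ℂ) (n : ℕ) : ℝ :=
  ∑ i ∈ Finset.range n, decreasingRearrangement x i

theorem decreasingRearrangement_nonneg (x : ℕ → ℂ) (n : ℕ) :
    0 ≤ decreasingRearrangement x n :=
  Real.sInf_nonneg fun _ ht => ht.1

theorem rearrangedSum_nonneg (x : ℕ → ℂ) (n : ℕ) : 0 ≤ rearrangedSum x n :=
  Finset.sum_nonneg fun _ _ => decreasingRearrangement_nonneg x _

/-- Every sum of `n` moduli is at most the sum of the first `n` rearranged terms. -/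
theorem sum_norm_le_rearrangedSum {x : ℕ → ℂ} (hx : BddAbove (Set.range fun j => ‖x j‖))
    (A : Finset ℕ) : ∑ j ∈ A, ‖x j‖ ≤ rearrangedSum x A.card := by
  induction hn : A.card generalizing A with
  | zero => simp [Finset.card_eq_zero.mp hn, rearrangedSum]
  | succ n ih =>
    have hne : A.Nonempty := Finset.card_pos.mp (by omega)
    obtain ⟨j, hj, hmin⟩ := A.exists_min_image (fun j => ‖x j‖) hne
    have h1 := ih (A.erase j) (by rw [Finset.card_erase_of_mem hj]; omega)
    have h2 : ‖x j‖ ≤ decreasingRearrangement x n := by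
      apply le_csInf
      · obtain ⟨M, hM⟩ := hx
        refine ⟨max M 0, le_max_right _ _, ?_⟩
        have : {j : ℕ | max M 0 < ‖x j‖} = ∅ := by
          ext k
          simp only [Set.mem_ofPred_eq, Set.mem_empty_iff_false, iff_false, not_lt]
          exact (hM ⟨k, rfl⟩).trans (le_max_left _ _)
        rw [this, Set.encard_empty]
        exact bot_le
      · rintro t ⟨-, ht⟩
        by_contra! hlt
        have hsub : (A : Set ℕ) ⊆ {j : ℕ | t < ‖x j‖} := fun k hk =>
          hlt.trans_le (hmin k hk)
        have h3 := (Set.encard_le_encard hsub).trans ht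
        rw [Set.encard_coe_eq_coe_finsetCard, hn] at h3
        have h4 : n + 1 ≤ n := by exact_mod_cast h3
        omega
    rw [← Finset.sum_erase_add _ _ hj, rearrangedSum, Finset.sum_range_succ]
    exact add_le_add h1 h2

/-- The sum of the first `n` rearranged terms is approximated by sums of `n` moduli. -/
theorem exists_rearrangedSum_le (x : ℕ → ℂ) {ε : ℝ} (hε : 0 < ε) (n : ℕ) :
    ∃ A : Finset ℕ, A.card = n ∧ rearrangedSum x n ≤ ∑ j ∈ A, ‖x j‖ + n * ε := by
  induction n with
  | zero => exact ⟨∅, by simp [rearrangedSum]⟩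
  | succ n ih =>
    obtain ⟨A, hA, hle⟩ := ih
    have : ∃ j, j ∉ A ∧ decreasingRearrangement x n - ε < ‖x j‖ := by
      by_contra! hcon
      have hsub : {j : ℕ | decreasingRearrangement x n - ε < ‖x j‖} ⊆ (A : Set ℕ) := by
        intro j hj
        by_contra hjA
        exact absurd (hcon j hjA) (not_le.mpr hj)
      have hcard := Set.encard_le_encard hsub
      rw [Set.encard_coe_eq_coe_finsetCard, hA] at hcard
      rcases le_or_gt 0 (decreasingRearrangement x n - ε) with h0 | h0
      · have : decreasingRearrangement x n ≤ decreasingRearrangement x n - ε :=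
          csInf_le ⟨0, fun t ht => ht.1⟩ ⟨h0, hcard⟩
        linarith
      · obtain ⟨j, hj⟩ := Infinite.exists_notMem_finset A
        have := hcon j hj
        linarith [norm_nonneg (x j)]
    obtain ⟨j, hj, hlt⟩ := this
    refine ⟨insert j A, by rw [Finset.card_insert_of_notMem hj, hA], ?_⟩
    rw [Finset.sum_insert hj, rearrangedSum, Finset.sum_range_succ]
    rw [rearrangedSum] at hle
    push_cast
    linarith

theorem rearrangedSum_le_of_forall {z : ℕ → ℂ} {n : ℕ} {C : ℝ}
    (h : ∀ A : Finset ℕ, A.card = n → ∑ j ∈ A, ‖z j‖ ≤ C) : rearrangedSum z n ≤ C := by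
  apply le_of_forall_pos_le_add
  intro δ hδ
  obtain ⟨A, hA, hle⟩ := exists_rearrangedSum_le z (ε := δ / (n + 1)) (by positivity) n
  have h1 : (n : ℝ) * (δ / (n + 1)) ≤ δ := by
    rw [← mul_div_assoc, div_le_iff₀ (by positivity)]
    nlinarith
  linarith [h A hA]

theorem rearrangedSum_add_le {x y : ℕ → ℂ} (hx : BddAbove (Set.range fun j => ‖x j‖))
    (hy : BddAbove (Set.range fun j => ‖y j‖)) (n : ℕ) :
    rearrangedSum (x + y) n ≤ rearrangedSum x n + rearrangedSum y n := by
  apply rearrangedSum_le_of_forall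
  rintro A rfl
  calc ∑ j ∈ A, ‖(x + y) j‖ ≤ ∑ j ∈ A, (‖x j‖ + ‖y j‖) :=
        Finset.sum_le_sum fun j _ => norm_add_le _ _
    _ = ∑ j ∈ A, ‖x j‖ + ∑ j ∈ A, ‖y j‖ := Finset.sum_add_distrib
    _ ≤ _ := add_le_add (sum_norm_le_rearrangedSum hx A) (sum_norm_le_rearrangedSum hy A)

theorem rearrangedSum_smul_le (c : ℂ) {x : ℕ → ℂ}
    (hx : BddAbove (Set.range fun j => ‖x j‖)) (n : ℕ) :
    rearrangedSum (c • x) n ≤ ‖c‖ * rearrangedSum x n := by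
  apply rearrangedSum_le_of_forall
  rintro A rfl
  calc ∑ j ∈ A, ‖(c • x) j‖ = ‖c‖ * ∑ j ∈ A, ‖x j‖ := by
        simp [Finset.mul_sum]
    _ ≤ _ := mul_le_mul_of_nonneg_left (sum_norm_le_rearrangedSum hx A) (norm_nonneg c)

theorem rearrangedSum_zero (n : ℕ) : rearrangedSum 0 n = 0 :=
  le_antisymm (rearrangedSum_le_of_forall (by simp)) (rearrangedSum_nonneg _ _)

theorem rearrangedSum_neg (x : ℕ → ℂ) (n : ℕ) : rearrangedSum (-x) n = rearrangedSum x n := by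
  simp [rearrangedSum, decreasingRearrangement]

theorem AdmissibleSeq.partialSum_pos (w : AdmissibleSeq) (n : ℕ) :
    0 < w.partialSum (n + 1) := by
  rw [AdmissibleSeq.partialSum, Finset.sum_range_succ', w.first]
  have := Finset.sum_nonneg fun i (_ : i ∈ Finset.range n) => w.nonneg (i + 1)
  linarith

/-- The vector space underlying the complex predual `d_*(w,1)`: bounded complex sequences `x` with
`(x* 0 + ⋯ + x* (n - 1)) / (w 0 + ⋯ + w (n - 1)) → 0` as `n → ∞`. -/
def lorentzPredualSubmodule (w : AdmissibleSeq) : Submodule ℂ (ℕ → ℂ) where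
  carrier := {x | BddAbove (Set.range fun j => ‖x j‖) ∧
    Filter.Tendsto (fun n => rearrangedSum x n / w.partialSum n) Filter.atTop (nhds 0)}
  zero_mem' := ⟨⟨0, by rintro _ ⟨j, rfl⟩; simp⟩, by simp [rearrangedSum_zero]⟩
  add_mem' := by
    rintro x y ⟨hx, hx'⟩ ⟨hy, hy'⟩
    constructor
    · obtain ⟨M, hM⟩ := hx
      obtain ⟨M', hM'⟩ := hy
      refine ⟨M + M', ?_⟩
      rintro _ ⟨j, rfl⟩
      exact (norm_add_le _ _).trans (add_le_add (hM ⟨j, rfl⟩) (hM' ⟨j, rfl⟩))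
    · have hlim := hx'.add hy'
      rw [add_zero] at hlim
      have hW : ∀ n, 0 ≤ w.partialSum n := fun n => Finset.sum_nonneg fun i _ => w.nonneg i
      refine squeeze_zero (fun n => div_nonneg (rearrangedSum_nonneg _ _) (hW n)) (fun n => ?_) hlim
      rw [← add_div]
      exact div_le_div_of_nonneg_right (rearrangedSum_add_le hx hy n) (hW n)
  smul_mem' := by
    rintro c x ⟨hx, hx'⟩
    constructor
    · obtain ⟨M, hM⟩ := hx
      refine ⟨‖c‖ * M, ?_⟩
      rintro _ ⟨j, rfl⟩
      simpa using mul_le_mul_of_nonneg_left (hM ⟨j, rfl⟩) (norm_nonneg c)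
    · have hlim := hx'.const_mul ‖c‖
      rw [mul_zero] at hlim
      have hW : ∀ n, 0 ≤ w.partialSum n := fun n => Finset.sum_nonneg fun i _ => w.nonneg i
      refine squeeze_zero (fun n => div_nonneg (rearrangedSum_nonneg _ _) (hW n)) (fun n => ?_) hlim
      rw [← mul_div_assoc]
      exact div_le_div_of_nonneg_right (rearrangedSum_smul_le c hx n) (hW n)

/-- The complex Banach space `d_*(w,1)`, the predual of the Lorentz sequence space `d(w,1)`.
It is a type of its own, so that it carries the norm below and not the product topology. -/
def LorentzPredual (w : AdmissibleSeq) : Type := ↥(lorentzPredualSubmodule w)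

namespace LorentzPredual

variable {w : AdmissibleSeq}

instance : AddCommGroup (LorentzPredual w) :=
  inferInstanceAs (AddCommGroup ↥(lorentzPredualSubmodule w))

instance : Module ℂ (LorentzPredual w) :=
  inferInstanceAs (Module ℂ ↥(lorentzPredualSubmodule w))

/-- The underlying sequence. -/
def seq (x : LorentzPredual w) : ℕ → ℂ := Subtype.val x

theorem bddAbove_seq (x : LorentzPredual w) : BddAbove (Set.range fun j => ‖x.seq j‖) :=
  x.2.1

theorem tendsto_ratio (x : LorentzPredual w) : Filter.Tendsto
    (fun n => rearrangedSum x.seq (n + 1) / w.partialSum (n + 1)) Filter.atTop (nhds 0) :=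
  x.2.2.comp (Filter.tendsto_add_atTop_nat 1)

/-- The norm of `d_*(w,1)`:
`sup_{n ≥ 1} (x* 0 + ⋯ + x* (n - 1)) / (w 0 + ⋯ + w (n - 1))`. -/
def lorentzNorm (x : LorentzPredual w) : ℝ :=
  ⨆ n : ℕ, rearrangedSum x.seq (n + 1) / w.partialSum (n + 1)

theorem bddAbove_ratio (x : LorentzPredual w) : BddAbove
    (Set.range fun n : ℕ => rearrangedSum x.seq (n + 1) / w.partialSum (n + 1)) :=
  x.tendsto_ratio.bddAbove_range

theorem ratio_le_lorentzNorm (x : LorentzPredual w) (n : ℕ) :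
    rearrangedSum x.seq (n + 1) / w.partialSum (n + 1) ≤ x.lorentzNorm :=
  le_ciSup x.bddAbove_ratio n

theorem norm_seq_le_lorentzNorm (x : LorentzPredual w) (j : ℕ) : ‖x.seq j‖ ≤ x.lorentzNorm := by
  have h1 := sum_norm_le_rearrangedSum x.bddAbove_seq {j}
  have h2 := x.ratio_le_lorentzNorm 0
  have h3 : w.partialSum (0 + 1) = 1 := by simp [AdmissibleSeq.partialSum, w.first]
  rw [h3, div_one] at h2
  simp only [Finset.sum_singleton, Finset.card_singleton] at h1
  exact h1.trans h2

instance : NormedAddCommGroup (LorentzPredual w) :=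
  AddGroupNorm.toNormedAddCommGroup
    { toFun := lorentzNorm
      map_zero' := by
        have h : (0 : LorentzPredual w).seq = 0 := rfl
        simp [lorentzNorm, h, rearrangedSum_zero]
      add_le' := fun x y => by
        refine ciSup_le fun n => ?_
        have h : (x + y).seq = x.seq + y.seq := rfl
        calc rearrangedSum (x + y).seq (n + 1) / w.partialSum (n + 1)
            ≤ (rearrangedSum x.seq (n + 1) + rearrangedSum y.seq (n + 1)) /
                w.partialSum (n + 1) := by
              rw [h]
              exact div_le_div_of_nonneg_right
                (rearrangedSum_add_le x.bddAbove_seq y.bddAbove_seq _) (w.partialSum_pos n).le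
          _ ≤ _ := by
              rw [add_div]
              exact add_le_add (x.ratio_le_lorentzNorm n) (y.ratio_le_lorentzNorm n)
      neg' := fun x => by
        have h : (-x).seq = -x.seq := rfl
        simp only [lorentzNorm, h, rearrangedSum_neg]
      eq_zero_of_map_eq_zero' := fun x hx => by
        apply Subtype.ext
        funext j
        have h1 : ‖x.seq j‖ ≤ 0 := (x.norm_seq_le_lorentzNorm j).trans hx.le
        exact norm_le_zero_iff.mp h1 }

theorem norm_def (x : LorentzPredual w) :
    ‖x‖ = ⨆ n : ℕ, rearrangedSum x.seq (n + 1) / w.partialSum (n + 1) := rfl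

instance : NormedSpace ℂ (LorentzPredual w) where
  norm_smul_le c x := by
    refine ciSup_le fun n => ?_
    have h : (c • x).seq = c • x.seq := rfl
    calc rearrangedSum (c • x).seq (n + 1) / w.partialSum (n + 1)
        ≤ (‖c‖ * rearrangedSum x.seq (n + 1)) / w.partialSum (n + 1) := by
          rw [h]
          exact div_le_div_of_nonneg_right
            (rearrangedSum_smul_le c x.bddAbove_seq _) (w.partialSum_pos n).le
      _ ≤ ‖c‖ * ‖x‖ := by
          rw [mul_div_assoc]
          exact mul_le_mul_of_nonneg_left (x.ratio_le_lorentzNorm n) (norm_nonneg c)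

end LorentzPredual

/-- The algebra `A_u(X)` of scalar functions that are uniformly continuous on the closed unit ball
of the complex normed space `X` and holomorphic (complex Fréchet differentiable) on the open unit
ball, with the supremum norm over the closed unit ball. Such functions are automatically bounded,
because the ball is convex and bounded. -/
def BallAlgebra (X : Type*) [NormedAddCommGroup X] [NormedSpace ℂ X] :
    Submodule ℂ (↥(Metric.closedBall (0 : X) 1) →ᵇ ℂ) where
  carrier := {f | UniformContinuous f ∧
    ∃ F : X → ℂ, (∀ x : ↥(Metric.closedBall (0 : X) 1), F x = f x) ∧
      DifferentiableOn ℂ F (Metric.ball 0 1)}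
  zero_mem' := ⟨uniformContinuous_const, 0, fun _ => rfl, differentiableOn_const 0⟩
  add_mem' := by
    rintro f g ⟨hf, F, hF, hF'⟩ ⟨hg, G, hG, hG'⟩
    exact ⟨hf.add hg, F + G, fun x => by simp [hF, hG], hF'.add hG'⟩
  smul_mem' := by
    rintro c f ⟨hf, F, hF, hF'⟩
    exact ⟨hf.const_smul c, c • F, fun x => by simp [hF], hF'.const_smul c⟩

/-- The norm `‖f‖_s = sup {|f x| : ‖x‖ ≤ s}` on `A_u(X)`, for `0 < s ≤ 1`. -/
def BallAlgebra.normOn {X : Type*} [NormedAddCommGroup X] [NormedSpace ℂ X]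
    (s : ℝ) (f : BallAlgebra X) : ℝ :=
  sSup {r : ℝ | ∃ x : ↥(Metric.closedBall (0 : X) 1), ‖(x : X)‖ ≤ s ∧ r = ‖f.1 x‖}

/-- `f` attains its `‖·‖_s`-norm: `|f x₀| = ‖f‖_s` for some `x₀` with `‖x₀‖ ≤ s`. -/
def BallAlgebra.AttainsNormOn {X : Type*} [NormedAddCommGroup X] [NormedSpace ℂ X]
    (s : ℝ) (f : BallAlgebra X) : Prop :=
  ∃ x : ↥(Metric.closedBall (0 : X) 1), ‖(x : X)‖ ≤ s ∧ ‖f.1 x‖ = BallAlgebra.normOn s f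

end

/-! Suppose first that `w ∈ ℓ_N`. The decreasing rearrangement of `x` is weakly majorized by `‖x‖
w`, so `∑ |x i|^N ≤ ‖x‖^N ∑ w i^N` (`sum_norm_pow_le`) and `p x = ∑ (x i)^N` belongs to `A_u`. Let
`h` attain its `‖·‖_s`-norm at `x₀`. Balls of `d_*(w,1)` have no complex extreme points: for some
unit vector `e` all `x₀ + t e` with small `t` stay in the ball of radius `s`
(`exists_norm_add_single_le`). By the maximum modulus principle `t ↦ h (x₀ + t e)` is constant near
`0`, whereas `t ↦ p (x₀ + t e)` has `N`-th derivative `N!` there. Since `s < 1`, Cauchy's estimate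
on the circle of radius `(1 - s) / 2` bounds `‖p - h‖` below by `((1 - s) / 2)^N`.

Suppose now that `w` lies in no `ℓ_N`. Every `f` is then a uniform limit of its compositions with
truncations (`eventually_norm_sub_truncBall_le`), and these attain their norms because they depend
on finitely many coordinates and truncation is contractive (`attainsNormOn_of_trunc`). Dilation and
Taylor expansion reduce the approximation to homogeneous `P`, where two facts are combined.

(a) A homogeneous `q` of degree `m ≥ 1` is small on bounded vectors made of at most `K` far
coordinates and of a part with uniformly small coordinates (`eventually_norm_lt`). Otherwise such
vectors, with coefficients `θ j * w j` and `|θ j| = 1`, would have bounded sums at which `|q| ≥ ε ∑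
w j^m`. With compactness for coordinatewise convergence, truncation hardly changes `P` on vectors
with at most `K` large coordinates, the others being small enough (`exists_norm_sub_restrict_lt`).

(b) Deleting disjoint pieces of `x` changes `P` by amounts with bounded sum
(`exists_sum_norm_sub_restrict_le`). A vector of the unit ball has boundedly many coordinates above
`η`; only those of intermediate size prevent the use of (a). Among many disjoint levels of size, one
can be deleted at little cost both from `x` and from its truncation
(`eventually_norm_sub_restrict_lt`).

Both facts need phases for which values of `q` add up; a mean over roots of unity provides them
(`HomEntire.exists_norm_add_le`). Taylor terms are studied through complex lines only, without
symmetric multilinear forms. -/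

noncomputable section

open Filter Topology Metric

/-! ### Taylor expansion of line-holomorphic functions on a normed space. -/

section Taylor

variable {X : Type*} [NormedAddCommGroup X] [NormedSpace ℂ X]

/-- Continuous `m`-homogeneous functions of growth at most `‖x‖ ^ m` that are entire on every
complex line. -/
structure HomEntire (m : ℕ) (q : X → ℂ) : Prop where
  cont : Continuous q
  hom : ∀ (c : ℂ) (x : X), q (c • x) = c ^ m * q x
  bound : ∃ C : ℝ, 0 ≤ C ∧ ∀ x, ‖q x‖ ≤ C * ‖x‖ ^ m
  line : ∀ a b : X, Differentiable ℂ fun t : ℂ => q (a + t • b)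

/-- Continuous functions on the ball of radius `R`, bounded by `C` there and holomorphic on the
intersection of the ball with every complex line. -/
structure LineHolomorphic (R C : ℝ) (F : X → ℂ) : Prop where
  pos : 0 < R
  cont : ContinuousOn F (ball 0 R)
  bound : ∀ x, ‖x‖ < R → ‖F x‖ ≤ C
  line : ∀ a b : X, DifferentiableOn ℂ (fun t : ℂ => F (a + t • b)) {t | ‖a + t • b‖ < R}

/-- The homogeneous term of degree `m` in the Taylor expansion of `F` at `0`. -/
def taylorTerm (F : X → ℂ) (m : ℕ) (x : X) : ℂ :=
  (m.factorial : ℂ)⁻¹ * iteratedDeriv m (fun t : ℂ => F (t • x)) 0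

namespace LineHolomorphic

variable {R C : ℝ} {F : X → ℂ}

theorem nonneg (h : LineHolomorphic R C F) : 0 ≤ C :=
  (norm_nonneg _).trans (h.bound 0 (by simpa using h.pos))

theorem differentiableOn_ball (h : LineHolomorphic R C F) (x : X) {ρ : ℝ} (hρ : ρ * ‖x‖ ≤ R) :
    DifferentiableOn ℂ (fun t : ℂ => F (t • x)) (ball 0 ρ) := by
  have h1 := h.line 0 x
  simp only [zero_add] at h1
  refine h1.mono fun t ht => ?_
  simp only [mem_ball_zero_iff] at ht
  show ‖t • x‖ < R
  rw [norm_smul]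
  rcases (norm_nonneg x).eq_or_lt with h0 | h0
  · rw [← h0, mul_zero]; exact h.pos
  · exact (mul_lt_mul_of_pos_right ht h0).trans_le hρ

theorem hasSum_smul (h : LineHolomorphic R C F) {x : X} {t : ℂ} (ht : ‖t • x‖ < R) :
    HasSum (fun m => t ^ m * taylorTerm F m x) (F (t • x)) := by
  rw [norm_smul] at ht
  -- A radius exceeding `‖t‖` with `ρ * ‖x‖ ≤ R`; the `+ 1` covers `x = 0`.
  set ρ := ‖t‖ + (R - ‖t‖ * ‖x‖) / (‖x‖ + 1) with hρ
  have hx := norm_nonneg x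
  have h1 : ρ * ‖x‖ ≤ R := by
    have h2 : (R - ‖t‖ * ‖x‖) / (‖x‖ + 1) * ‖x‖ ≤ R - ‖t‖ * ‖x‖ := by
      rw [div_mul_eq_mul_div, div_le_iff₀ (by positivity)]
      nlinarith
    rw [hρ, add_mul]; linarith
  have h3 : t ∈ ball (0 : ℂ) ρ := by
    rw [mem_ball_zero_iff, hρ]
    have : 0 < (R - ‖t‖ * ‖x‖) / (‖x‖ + 1) := div_pos (by linarith) (by positivity)
    linarith
  have h4 := Complex.hasSum_taylorSeries_on_ball (h.differentiableOn_ball x h1) h3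
  refine (funext fun m => ?_ : (fun m => t ^ m * taylorTerm F m x) = _) ▸ h4
  simp only [sub_zero, smul_eq_mul, taylorTerm]
  ring

theorem hasSum (h : LineHolomorphic R C F) {x : X} (hx : ‖x‖ < R) :
    HasSum (fun m => taylorTerm F m x) (F x) := by
  simpa using h.hasSum_smul (x := x) (t := 1) (by simpa using hx)

theorem norm_taylorTerm_le (h : LineHolomorphic R C F) (m : ℕ) (x : X) :
    ‖taylorTerm F m x‖ ≤ C * (‖x‖ / R) ^ m := by
  have hR := h.pos
  -- Cauchy's estimate on the circle of radius `R / (‖x‖ + ε)`: the `ε` keeps the circle strictly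
  -- inside the domain and the radius finite when `x = 0`. Then `ε → 0`.
  have key : ∀ ε : ℝ, 0 < ε → ‖taylorTerm F m x‖ ≤ C * ((‖x‖ + ε) / R) ^ m := by
    intro ε hε
    have hx := norm_nonneg x
    set ρ := R / (‖x‖ + ε) with hρ
    have hρ0 : 0 < ρ := by positivity
    have h1 : ρ * ‖x‖ < R := by
      rw [hρ, div_mul_eq_mul_div, div_lt_iff₀ (by positivity)]
      nlinarith
    obtain ⟨ρ', hρ', h2⟩ : ∃ ρ' > ρ, ρ' * ‖x‖ ≤ R := by
      refine ⟨ρ + (R - ρ * ‖x‖) / (‖x‖ + 1), ?_, ?_⟩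
      · have : 0 < (R - ρ * ‖x‖) / (‖x‖ + 1) := div_pos (by linarith) (by positivity)
        linarith
      · have h2 : (R - ρ * ‖x‖) / (‖x‖ + 1) * ‖x‖ ≤ R - ρ * ‖x‖ := by
          rw [div_mul_eq_mul_div, div_le_iff₀ (by positivity)]
          nlinarith
        rw [add_mul]; linarith
    have hd : DiffContOnCl ℂ (fun t : ℂ => F (t • x)) (ball 0 ρ) :=
      ((h.differentiableOn_ball x h2).mono
        (closure_ball_subset_closedBall.trans (closedBall_subset_ball hρ'))).diffContOnCl
    have h3 := Complex.norm_iteratedDeriv_le_of_forall_mem_sphere_norm_le m hρ0 hd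
      (C := C) (fun z hz => h.bound _ (by
        rw [mem_sphere_zero_iff_norm] at hz
        rw [norm_smul, hz]; exact h1))
    rw [taylorTerm, norm_mul, norm_inv, Complex.norm_natCast]
    have hf : (0 : ℝ) < m.factorial := by positivity
    calc (m.factorial : ℝ)⁻¹ * _ ≤ (m.factorial : ℝ)⁻¹ * (m.factorial * C / ρ ^ m) := by gcongr
      _ = C * ((‖x‖ + ε) / R) ^ m := by
        rw [hρ, ← inv_div R (‖x‖ + ε), inv_pow]; field_simp
  have hlim : Tendsto (fun ε : ℝ => C * ((‖x‖ + ε) / R) ^ m) (𝓝[>] 0)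
      (𝓝 (C * ((‖x‖ + 0) / R) ^ m)) := by
    apply Tendsto.mono_left _ nhdsWithin_le_nhds
    apply Continuous.tendsto
    fun_prop
  rw [add_zero] at hlim
  exact ge_of_tendsto hlim (eventually_nhdsWithin_of_forall key)

theorem norm_sub_sum_le (h : LineHolomorphic R C F) {ρ : ℝ} (h0 : 0 ≤ ρ) (h1 : ρ < 1) {x : X}
    (hx : ‖x‖ ≤ ρ * R) (m : ℕ) :
    ‖F x - ∑ j ∈ Finset.range m, taylorTerm F j x‖ ≤ C * ρ ^ m * (1 - ρ)⁻¹ := by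
  have hR := h.pos
  have hC := h.nonneg
  have h2 := (hasSum_nat_add_iff' m).mpr (h.hasSum (x := x) (by nlinarith))
  refine h2.norm_le_of_bounded ((hasSum_geometric_of_lt_one h0 h1).mul_left (C * ρ ^ m))
    fun j => (h.norm_taylorTerm_le _ x).trans ?_
  rw [add_comm, pow_add, ← mul_assoc]
  have : ‖x‖ / R ≤ ρ := by rwa [div_le_iff₀ hR]
  gcongr

/-- The Taylor term of degree `m` is the limit of the `m`-th difference quotients. -/
theorem norm_quotient_sub_le (h : LineHolomorphic R C F) {x : X} {t : ℂ} (ht : t ≠ 0)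
    (hx : ‖t‖ * ‖x‖ ≤ R / 2) (m : ℕ) :
    ‖(F (t • x) - ∑ j ∈ Finset.range m, t ^ j * taylorTerm F j x) / t ^ m - taylorTerm F m x‖
      ≤ ‖t‖ * (2 * C * (‖x‖ / R) ^ (m + 1)) := by
  have hR := h.pos
  have hC := h.nonneg
  have ht' : 0 < ‖t‖ := norm_pos_iff.mpr ht
  have h1 := (hasSum_nat_add_iff' (m + 1)).mpr
    (h.hasSum_smul (x := x) (t := t) (by rw [norm_smul]; linarith))
  have h2 : HasSum (fun j : ℕ => C * (‖t‖ * ‖x‖ / R) ^ (m + 1) * (1 / 2) ^ j)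
      (C * (‖t‖ * ‖x‖ / R) ^ (m + 1) * 2) := hasSum_geometric_two.mul_left _
  have h3 := h1.norm_le_of_bounded h2 (fun j => by
    rw [norm_mul, norm_pow]
    calc ‖t‖ ^ (j + (m + 1)) * ‖taylorTerm F (j + (m + 1)) x‖
        ≤ ‖t‖ ^ (j + (m + 1)) * (C * (‖x‖ / R) ^ (j + (m + 1))) := by
          gcongr; exact h.norm_taylorTerm_le _ x
      _ = C * (‖t‖ * ‖x‖ / R) ^ (m + 1) * (‖t‖ * ‖x‖ / R) ^ j := by
          rw [mul_div_assoc, mul_pow, mul_pow, pow_add, pow_add]; ring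
      _ ≤ _ := by
          refine mul_le_mul_of_nonneg_left ?_ (by positivity)
          gcongr ?_ ^ j
          rw [div_le_iff₀ hR]; linarith)
  have h4 : (F (t • x) - ∑ j ∈ Finset.range m, t ^ j * taylorTerm F j x) / t ^ m
      - taylorTerm F m x
      = (F (t • x) - ∑ j ∈ Finset.range (m + 1), t ^ j * taylorTerm F j x) / t ^ m := by
    rw [Finset.sum_range_succ]
    field_simp
    ring
  rw [h4, norm_div, norm_pow, div_le_iff₀ (by positivity)]
  refine h3.trans (le_of_eq ?_)
  rw [mul_div_assoc, mul_pow, pow_succ]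
  ring

/-- Uniformity on bounded sets lets continuity and holomorphy on lines pass from `F` and the lower
Taylor terms to the term of degree `m`, by strong induction. -/
theorem tendsto_quotient (h : LineHolomorphic R C F) (m : ℕ) (A : ℝ) :
    TendstoUniformlyOn (fun (t : ℂ) (x : X) =>
      (F (t • x) - ∑ j ∈ Finset.range m, t ^ j * taylorTerm F j x) / t ^ m)
      (taylorTerm F m) (𝓝[≠] 0) (ball 0 A) := by
  have hR := h.pos
  have hC := h.nonneg
  rw [Metric.tendstoUniformlyOn_iff]
  intro ε hε
  have h1 : ∀ᶠ t : ℂ in 𝓝[≠] 0, ‖t‖ * |A| < R / 2 := by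
    apply nhdsWithin_le_nhds
    have : Tendsto (fun t : ℂ => ‖t‖ * |A|) (𝓝 0) (𝓝 (‖(0 : ℂ)‖ * |A|)) :=
      Continuous.tendsto (by fun_prop) 0
    rw [norm_zero, zero_mul] at this
    exact this.eventually_lt_const (by positivity)
  have h2 : ∀ᶠ t : ℂ in 𝓝[≠] 0, ‖t‖ * (2 * C * (|A| / R) ^ (m + 1)) < ε := by
    apply nhdsWithin_le_nhds
    have : Tendsto (fun t : ℂ => ‖t‖ * (2 * C * (|A| / R) ^ (m + 1))) (𝓝 0)
        (𝓝 (‖(0 : ℂ)‖ * (2 * C * (|A| / R) ^ (m + 1)))) :=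
      Continuous.tendsto (by fun_prop) 0
    rw [norm_zero, zero_mul] at this
    exact this.eventually_lt_const hε
  filter_upwards [h1, h2, self_mem_nhdsWithin] with t ht1 ht2 ht0 x hx
  rw [mem_ball_zero_iff] at hx
  have hxA : ‖x‖ ≤ |A| := hx.le.trans (le_abs_self A)
  rw [dist_comm, dist_eq_norm]
  refine (h.norm_quotient_sub_le ht0 ?_ m).trans_lt (lt_of_le_of_lt ?_ ht2)
  · exact (mul_le_mul_of_nonneg_left hxA (norm_nonneg _)).trans ht1.le
  · gcongr

/-- By induction, the quotient at `c • x` with parameter `t` is `c ^ m` times the quotient at `x`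
with parameter `t * c`. -/
theorem taylorTerm_smul (h : LineHolomorphic R C F) (m : ℕ) (c : ℂ) (x : X) :
    taylorTerm F m (c • x) = c ^ m * taylorTerm F m x := by
  induction m using Nat.strong_induction_on with
  | _ m ih =>
  rcases eq_or_ne c 0 with rfl | hc
  · rcases Nat.eq_zero_or_pos m with rfl | hm
    · simp [taylorTerm]
    · have := h.norm_taylorTerm_le m (0 : X)
      rw [norm_zero, zero_div, zero_pow hm.ne', mul_zero] at this
      rw [zero_smul, zero_pow hm.ne', zero_mul]
      exact norm_le_zero_iff.mp this
  · have t1 := (h.tendsto_quotient m (‖c • x‖ + 1)).tendsto_at (x := c • x)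
      (by rw [mem_ball_zero_iff]; linarith)
    have t2 := (h.tendsto_quotient m (‖x‖ + 1)).tendsto_at (x := x)
      (by rw [mem_ball_zero_iff]; linarith)
    have t3 : Tendsto (fun t : ℂ => t * c) (𝓝[≠] 0) (𝓝[≠] 0) := by
      apply tendsto_nhdsWithin_of_tendsto_nhds_of_eventually_within
      · have : Tendsto (fun t : ℂ => t * c) (𝓝 0) (𝓝 (0 * c)) :=
          Continuous.tendsto (by fun_prop) 0
        rw [zero_mul] at this
        exact this.mono_left nhdsWithin_le_nhds
      · filter_upwards [self_mem_nhdsWithin] with t ht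
        exact mul_ne_zero ht hc
    have t4 := (t2.comp t3).const_mul (c ^ m)
    refine tendsto_nhds_unique_of_eventuallyEq t1 t4 ?_
    filter_upwards [self_mem_nhdsWithin] with t ht
    have ht : t ≠ 0 := ht
    simp only [Function.comp]
    have hs : ∑ j ∈ Finset.range m, t ^ j * taylorTerm F j (c • x)
        = ∑ j ∈ Finset.range m, (t * c) ^ j * taylorTerm F j x :=
      Finset.sum_congr rfl fun j hj => by
        rw [ih j (Finset.mem_range.mp hj), mul_pow, mul_assoc]
    rw [hs, smul_smul, mul_pow t c m]
    field_simp

theorem eventually_smul_mem_ball (h : LineHolomorphic R C F) (A : ℝ) :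
    ∀ᶠ t : ℂ in 𝓝[≠] 0, ∀ x ∈ ball (0 : X) A, t • x ∈ ball (0 : X) R := by
  have hR := h.pos
  have h1 : ∀ᶠ t : ℂ in 𝓝[≠] 0, ‖t‖ * |A| < R := by
    apply nhdsWithin_le_nhds
    have : Tendsto (fun t : ℂ => ‖t‖ * |A|) (𝓝 0) (𝓝 (‖(0 : ℂ)‖ * |A|)) :=
      Continuous.tendsto (by fun_prop) 0
    rw [norm_zero, zero_mul] at this
    exact this.eventually_lt_const (by positivity)
  filter_upwards [h1] with t ht x hx
  rw [mem_ball_zero_iff] at hx ⊢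
  rw [norm_smul]
  exact (mul_le_mul_of_nonneg_left (hx.le.trans (le_abs_self A)) (norm_nonneg _)).trans_lt ht

theorem continuous_taylorTerm (h : LineHolomorphic R C F) (m : ℕ) :
    Continuous (taylorTerm F m) := by
  induction m using Nat.strong_induction_on with
  | _ m ih =>
  rw [continuous_iff_continuousAt]
  intro x
  have hmem : ball (0 : X) (‖x‖ + 1) ∈ 𝓝 x :=
    isOpen_ball.mem_nhds (by rw [mem_ball_zero_iff]; linarith)
  refine ContinuousOn.continuousAt ?_ hmem
  refine (h.tendsto_quotient m (‖x‖ + 1)).continuousOn (Eventually.frequently ?_)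
  filter_upwards [h.eventually_smul_mem_ball (‖x‖ + 1)] with t ht
  apply ContinuousOn.div_const
  apply ContinuousOn.sub
  · exact h.cont.comp (by fun_prop) ht
  · apply Continuous.continuousOn
    refine continuous_finsetSum _ fun j hj => ?_
    exact continuous_const.mul (ih j (Finset.mem_range.mp hj))

theorem line_taylorTerm (h : LineHolomorphic R C F) (m : ℕ) (a b : X) :
    Differentiable ℂ fun s : ℂ => taylorTerm F m (a + s • b) := by
  induction m using Nat.strong_induction_on with
  | _ m ih =>
  intro s₀
  set A := ‖a‖ + (‖s₀‖ + 1) * ‖b‖ + 1 with hA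
  have hsub : ∀ s ∈ ball (0 : ℂ) (‖s₀‖ + 1), a + s • b ∈ ball (0 : X) A := by
    intro s hs
    rw [mem_ball_zero_iff] at hs ⊢
    calc ‖a + s • b‖ ≤ ‖a‖ + ‖s‖ * ‖b‖ := by
          rw [← norm_smul]; exact norm_add_le _ _
      _ ≤ ‖a‖ + (‖s₀‖ + 1) * ‖b‖ := by gcongr
      _ < A := by rw [hA]; linarith
  have hmem : ball (0 : ℂ) (‖s₀‖ + 1) ∈ 𝓝 s₀ :=
    isOpen_ball.mem_nhds (by rw [mem_ball_zero_iff]; linarith)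
  refine DifferentiableOn.differentiableAt ?_ hmem
  have hu : TendstoUniformlyOn (fun (t : ℂ) (s : ℂ) =>
      (F (t • (a + s • b)) - ∑ j ∈ Finset.range m, t ^ j * taylorTerm F j (a + s • b)) / t ^ m)
      (fun s : ℂ => taylorTerm F m (a + s • b)) (𝓝[≠] 0) (ball 0 (‖s₀‖ + 1)) := by
    have := (h.tendsto_quotient m A).comp (fun s : ℂ => a + s • b)
    exact this.mono hsub
  refine hu.tendstoLocallyUniformlyOn.differentiableOn ?_ isOpen_ball
  filter_upwards [h.eventually_smul_mem_ball A] with t ht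
  apply DifferentiableOn.div_const
  apply DifferentiableOn.sub
  · have h1 := h.line (t • a) (t • b)
    refine (h1.mono fun s hs => ?_).congr fun s hs => ?_
    · have := ht _ (hsub s hs)
      rw [mem_ball_zero_iff] at this
      show ‖t • a + s • t • b‖ < R
      rwa [smul_comm s t b, ← smul_add]
    · rw [smul_comm s t b, ← smul_add]
  · apply Differentiable.differentiableOn
    refine Differentiable.fun_sum fun j hj => ?_
    exact (ih j (Finset.mem_range.mp hj)).const_mul _

theorem homEntire_taylorTerm (h : LineHolomorphic R C F) (m : ℕ) :
    HomEntire m (taylorTerm F m) where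
  cont := h.continuous_taylorTerm m
  hom := h.taylorTerm_smul m
  bound := ⟨C / R ^ m, div_nonneg h.nonneg (pow_nonneg h.pos.le _), fun x =>
    (h.norm_taylorTerm_le m x).trans (le_of_eq (by rw [div_pow]; ring))⟩
  line := h.line_taylorTerm m

end LineHolomorphic

/-! ### Homogeneous functions on complex lines and the choice of phases. -/

namespace HomEntire

variable {m : ℕ} {q : X → ℂ}

theorem exists_norm_le (h : HomEntire m q) (r : ℝ) : ∃ C, 0 ≤ C ∧ ∀ x, ‖x‖ ≤ r → ‖q x‖ ≤ C := by
  obtain ⟨C, hC, hq⟩ := h.bound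
  refine ⟨C * |r| ^ m, by positivity, fun x hx => (hq x).trans ?_⟩
  gcongr
  exact hx.trans (le_abs_self r)

/-- Makes the Taylor expansion of `q` at an arbitrary centre `u` available. -/
theorem lineHolomorphic_add (h : HomEntire m q) {R C : ℝ} (hR : 0 < R) (u : X)
    (hC : ∀ x, ‖x‖ ≤ ‖u‖ + R → ‖q x‖ ≤ C) : LineHolomorphic R C fun x => q (u + x) where
  pos := hR
  cont := (h.cont.comp (continuous_const.add continuous_id)).continuousOn
  bound x hx := hC _ ((norm_add_le _ _).trans (by linarith))
  line a b := by
    have := (h.line (u + a) b).differentiableOn (s := {t : ℂ | ‖a + t • b‖ < R})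
    exact this.congr fun t _ => by rw [add_assoc]

/-- A function that is entire on a line and homogeneous is a polynomial there, with the expected
first and last coefficients. -/
theorem exists_coeff (h : HomEntire m q) (a b : X) : ∃ c : ℕ → ℂ, c 0 = q a ∧ c m = q b ∧
    ∀ t : ℂ, q (a + t • b) = ∑ i ∈ Finset.range (m + 1), c i * t ^ i := by
  set c : ℕ → ℂ := fun i => (i.factorial : ℂ)⁻¹ * iteratedDeriv i (fun t : ℂ => q (a + t • b)) 0
  obtain ⟨C, hC, hq⟩ := h.bound
  -- On a circle of radius `ρ ≥ 1` the function is `O(ρ ^ m)`, so Cauchy's estimate makes a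
  -- coefficient of index `n > m` of size `O(ρ⁻¹)`.
  have hvan : ∀ n, m < n → c n = 0 := by
    intro n hn
    have hest : ∀ ρ : ℝ, 1 ≤ ρ → ‖iteratedDeriv n (fun t : ℂ => q (a + t • b)) 0‖
        ≤ n.factorial * (C * (‖a‖ + ‖b‖) ^ m) * ρ⁻¹ := by
      intro ρ hρ
      have hρ0 : 0 < ρ := by linarith
      have := Complex.norm_iteratedDeriv_le_of_forall_mem_sphere_norm_le n hρ0
        (h.line a b).diffContOnCl (c := 0) (C := C * (ρ * (‖a‖ + ‖b‖)) ^ m) (fun z hz => by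
          rw [mem_sphere_zero_iff_norm] at hz
          refine (hq _).trans ?_
          gcongr
          refine (norm_add_le _ _).trans ?_
          rw [norm_smul, hz, mul_add]
          gcongr
          nlinarith [norm_nonneg a])
      refine this.trans ?_
      rw [div_le_iff₀ (by positivity), mul_pow]
      have e : ρ ^ m ≤ ρ⁻¹ * ρ ^ n := by
        obtain ⟨k, rfl⟩ := Nat.exists_eq_add_of_lt hn
        have : ρ⁻¹ * ρ ^ (m + k + 1) = ρ ^ m * ρ ^ k := by field_simp; ring
        rw [this]
        exact le_mul_of_one_le_right (by positivity) (one_le_pow₀ hρ)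
      calc (n.factorial : ℝ) * (C * (ρ ^ m * (‖a‖ + ‖b‖) ^ m))
          = n.factorial * (C * (‖a‖ + ‖b‖) ^ m) * ρ ^ m := by ring
        _ ≤ n.factorial * (C * (‖a‖ + ‖b‖) ^ m) * (ρ⁻¹ * ρ ^ n) := by gcongr
        _ = _ := by ring
    have hlim : Tendsto (fun ρ : ℝ => n.factorial * (C * (‖a‖ + ‖b‖) ^ m) * ρ⁻¹) atTop (𝓝 0) := by
      simpa using tendsto_inv_atTop_zero.const_mul (n.factorial * (C * (‖a‖ + ‖b‖) ^ m) : ℝ)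
    have h0 := ge_of_tendsto hlim ((eventually_ge_atTop 1).mono hest)
    simp only [c, norm_le_zero_iff.mp h0, mul_zero]
  have hsum : ∀ t : ℂ, q (a + t • b) = ∑ i ∈ Finset.range (m + 1), c i * t ^ i := by
    intro t
    have h1 := Complex.hasSum_taylorSeries_of_entire (h.line a b) 0 t
    refine h1.unique ?_
    have h2 : HasSum (fun i => c i * t ^ i) (∑ i ∈ Finset.range (m + 1), c i * t ^ i) :=
      hasSum_sum_of_ne_finset_zero (fun i hi => by
        rw [hvan i (by simpa [Nat.lt_succ_iff] using hi), zero_mul])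
    refine (funext fun i => ?_ : (fun i => c i * t ^ i) = _) ▸ h2
    simp only [c, sub_zero, smul_eq_mul]
    ring
  refine ⟨c, by simp [c], ?_, hsum⟩
  -- Homogeneity reverses the polynomial, so `c m` becomes the constant term in `s`; continuity then
  -- allows `s = 0`.
  have hrev : ∀ s : ℂ, s ≠ 0 →
      q (b + s • a) = ∑ i ∈ Finset.range (m + 1), c i * s ^ (m - i) := by
    intro s hs
    have e : b + s • a = s • (a + s⁻¹ • b) := by
      rw [smul_add, smul_smul, mul_inv_cancel₀ hs, one_smul, add_comm]
    rw [e, h.hom, hsum, Finset.mul_sum]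
    refine Finset.sum_congr rfl fun i hi => ?_
    have hi' : i ≤ m := Nat.lt_succ_iff.mp (Finset.mem_range.mp hi)
    rw [pow_sub₀ s hs hi', inv_pow]; ring
  have hc1 : Continuous fun s : ℂ => q (b + s • a) := (h.line b a).continuous
  have hc2 : Continuous fun s : ℂ => ∑ i ∈ Finset.range (m + 1), c i * s ^ (m - i) := by fun_prop
  have heq := hc1.ext_on (dense_compl_singleton (0 : ℂ)) hc2 (fun s hs => hrev s hs)
  have h0 := congrFun heq 0
  simp only [zero_smul, add_zero] at h0
  rw [h0, Finset.sum_eq_single m]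
  · simp
  · intro i hi him
    have : m - i ≠ 0 := by
      have := Finset.mem_range.mp hi
      omega
    rw [zero_pow this, mul_zero]
  · simp

/-- Averaging `q (a + ω ^ k • α • b)` over the `m`-th roots of unity leaves only the extreme
coefficients, that is `q a + q (α • b)`. Once `α` aligns the two values, some term of the mean has
modulus at least the sum of the moduli. -/
theorem exists_norm_add_le (h : HomEntire m q) (hm : 1 ≤ m) (a b : X) :
    ∃ θ : ℂ, ‖θ‖ = 1 ∧ ‖q a‖ + ‖q b‖ ≤ ‖q (a + θ • b)‖ := by
  have hm0 : m ≠ 0 := by omega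
  obtain ⟨α, hα, hαq⟩ : ∃ α : ℂ, ‖α‖ = 1 ∧ ‖q a + q (α • b)‖ = ‖q a‖ + ‖q b‖ := by
    obtain ⟨β, hβ, hβq⟩ : ∃ β : ℂ, ‖β‖ = 1 ∧ ‖q a + β * q b‖ = ‖q a‖ + ‖q b‖ := by
      refine ⟨Complex.exp ((Complex.arg (q a) - Complex.arg (q b) : ℝ) * Complex.I),
        Complex.norm_exp_ofReal_mul_I _, ?_⟩
      have e : q a + Complex.exp ((Complex.arg (q a) - Complex.arg (q b) : ℝ) * Complex.I) * q b
          = ((‖q a‖ + ‖q b‖ : ℝ) : ℂ) * Complex.exp (Complex.arg (q a) * Complex.I) := by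
        have ea := Complex.norm_mul_exp_arg_mul_I (q a)
        have eb := Complex.norm_mul_exp_arg_mul_I (q b)
        have ec : Complex.exp ((Complex.arg (q a) - Complex.arg (q b) : ℝ) * Complex.I)
            * Complex.exp (Complex.arg (q b) * Complex.I)
            = Complex.exp (Complex.arg (q a) * Complex.I) := by
          rw [← Complex.exp_add]
          congr 1
          push_cast
          ring
        push_cast at ec ⊢
        rw [add_mul, ea, ← ec]
        nth_rewrite 2 [← eb]
        ring
      rw [e, norm_mul, Complex.norm_exp_ofReal_mul_I, mul_one, Complex.norm_real,
        Real.norm_of_nonneg (by positivity)]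
    -- An `m`-th root, since `q (α • b) = α ^ m * q b`.
    obtain ⟨α, hα⟩ := IsAlgClosed.exists_pow_nat_eq β (Nat.pos_of_ne_zero hm0)
    refine ⟨α, ?_, by rw [h.hom, hα, hβq]⟩
    have : ‖α‖ ^ m = 1 := by rw [← norm_pow, hα, hβ]
    exact (pow_eq_one_iff_of_nonneg (norm_nonneg _) hm0).mp this
  obtain ⟨c, hc0, hcm, hc⟩ := h.exists_coeff a (α • b)
  set ω := Complex.exp (2 * Real.pi * Complex.I / m) with hω
  have hprim : IsPrimitiveRoot ω m := Complex.isPrimitiveRoot_exp m hm0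
  have havg : ∑ k ∈ Finset.range m, q (a + ω ^ k • α • b) = m * (q a + q (α • b)) := by
    simp only [hc]
    rw [Finset.sum_comm, Finset.sum_range_succ]
    obtain ⟨n, rfl⟩ : ∃ n, m = n + 1 := ⟨m - 1, by omega⟩
    rw [Finset.sum_range_succ']
    have hz : ∀ i ∈ Finset.range n,
        ∑ k ∈ Finset.range (n + 1), c (i + 1) * (ω ^ k) ^ (i + 1) = 0 := by
      intro i hi
      have hi := Finset.mem_range.mp hi
      rw [← Finset.mul_sum]
      have hne : ω ^ (i + 1) ≠ 1 := hprim.pow_ne_one_of_pos_of_lt (by omega) (by omega)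
      have hg := mul_geom_sum (ω ^ (i + 1)) (n + 1)
      rw [← pow_mul, mul_comm (i + 1) (n + 1), pow_mul, hprim.pow_eq_one, one_pow, sub_self] at hg
      have h0 := (mul_eq_zero.mp hg).resolve_left (sub_ne_zero.mpr hne)
      have : ∀ k ∈ Finset.range (n + 1), (ω ^ k) ^ (i + 1) = (ω ^ (i + 1)) ^ k :=
        fun k _ => by rw [← pow_mul, ← pow_mul, mul_comm]
      rw [Finset.sum_congr rfl this, h0, mul_zero]
    rw [Finset.sum_eq_zero hz, zero_add]
    have h1 : ∀ k ∈ Finset.range (n + 1), c (n + 1) * (ω ^ k) ^ (n + 1) = c (n + 1) :=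
      fun k _ => by rw [← pow_mul, mul_comm k, pow_mul, hprim.pow_eq_one, one_pow, mul_one]
    rw [Finset.sum_congr rfl h1]
    simp only [pow_zero, mul_one, Finset.sum_const, Finset.card_range, nsmul_eq_mul]
    rw [hc0, hcm]; ring
  have hω1 : ‖ω‖ = 1 := hprim.norm'_eq_one hm0
  by_contra! hcon
  have hlt : ∀ k ∈ Finset.range m, ‖q (a + ω ^ k • α • b)‖ < ‖q a‖ + ‖q b‖ := by
    intro k _
    rw [smul_smul]
    exact hcon _ (by rw [norm_mul, norm_pow, hω1, hα, one_pow, one_mul])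
  have h1 := (norm_sum_le _ _).trans_lt (Finset.sum_lt_sum_of_nonempty
    (Finset.nonempty_range_iff.mpr hm0) hlt)
  rw [havg, norm_mul, hαq, Complex.norm_natCast, Finset.sum_const, Finset.card_range,
    nsmul_eq_mul] at h1
  exact lt_irrefl _ h1

theorem exists_sum_norm_le (h : HomEntire m q) (hm : 1 ≤ m) {ι : Type*} (s : Finset ι)
    (b : ι → X) : ∃ θ : ι → ℂ, (∀ i, ‖θ i‖ = 1) ∧
      ∑ i ∈ s, ‖q (b i)‖ ≤ ‖q (∑ i ∈ s, θ i • b i)‖ := by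
  classical
  induction s using Finset.induction_on with
  | empty => exact ⟨fun _ => 1, by simp, by simp⟩
  | insert i s hi ih =>
    obtain ⟨θ, hθ, hle⟩ := ih
    obtain ⟨α, hα, hαle⟩ := h.exists_norm_add_le hm (∑ i ∈ s, θ i • b i) (b i)
    refine ⟨Function.update θ i α, fun j => ?_, ?_⟩
    · rcases eq_or_ne j i with rfl | hj
      · simpa using hα
      · simpa [hj] using hθ j
    · rw [Finset.sum_insert hi, Finset.sum_insert hi, Function.update_self]
      have : ∑ j ∈ s, Function.update θ i α j • b j = ∑ j ∈ s, θ j • b j :=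
        Finset.sum_congr rfl fun j hj => by
          rw [Function.update_of_ne (ne_of_mem_of_not_mem hj hi)]
      rw [this, add_comm (α • b i)]
      linarith

end HomEntire

end Taylor

/-! ### Elementary properties of the weights. -/

namespace AdmissibleSeq

variable (w : AdmissibleSeq)

theorem le_one (i : ℕ) : w i ≤ 1 := w.first ▸ w.antitone (Nat.zero_le i)

theorem pos (i : ℕ) : 0 < w i := by
  refine (w.nonneg i).lt_of_ne fun h => w.not_summable ?_
  refine summable_of_ne_finset_zero (s := Finset.range i) fun j hj => ?_
  have hj : i ≤ j := by simpa using hj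
  exact le_antisymm ((w.antitone hj).trans h.ge) (w.nonneg j)

theorem partialSum_zero : w.partialSum 0 = 0 := by simp [partialSum]

theorem partialSum_succ (n : ℕ) : w.partialSum (n + 1) = w.partialSum n + w n :=
  Finset.sum_range_succ _ _

theorem partialSum_nonneg (n : ℕ) : 0 ≤ w.partialSum n :=
  Finset.sum_nonneg fun i _ => w.nonneg i

theorem partialSum_mono : Monotone w.partialSum :=
  monotone_nat_of_le_succ fun n => by rw [partialSum_succ]; linarith [w.nonneg n]

theorem one_le_partialSum {n : ℕ} (hn : 1 ≤ n) : 1 ≤ w.partialSum n := by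
  refine le_trans ?_ (w.partialSum_mono hn)
  simp [partialSum, w.first]

theorem partialSum_le (n : ℕ) : w.partialSum n ≤ n := by
  simpa [partialSum] using Finset.sum_le_card_nsmul (Finset.range n) w 1 fun i _ => w.le_one i

theorem tendsto_partialSum : Tendsto w.partialSum atTop atTop :=
  (not_summable_iff_tendsto_nat_atTop_of_nonneg w.nonneg).mp w.not_summable

/-- The averages `W(k) / k` tend to `0` with `w`. This bounds, uniformly over the unit ball, the
number of coordinates of modulus above `η`. -/
theorem exists_card_le {η : ℝ} (hη : 0 < η) : ∃ K : ℕ, ∀ k : ℕ, η * k ≤ w.partialSum k → k ≤ K := by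
  have h := w.tendsto_zero.cesaro
  obtain ⟨K, hK⟩ := eventually_atTop.mp (h.eventually_lt_const hη)
  refine ⟨K, fun k hk => ?_⟩
  by_contra! hlt
  have h1 := hK k hlt.le
  have hk0 : (0 : ℝ) < k := by exact_mod_cast (Nat.zero_le K).trans_lt hlt
  rw [inv_mul_lt_iff₀ hk0] at h1
  have : w.partialSum k = ∑ i ∈ Finset.range k, w i := rfl
  linarith

end AdmissibleSeq

/-! ### Geometry of `d_*(w,1)`. -/

namespace LorentzPredual

variable {w : AdmissibleSeq}

theorem seq_zero : (0 : LorentzPredual w).seq = 0 := rfl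

theorem seq_add (x y : LorentzPredual w) (i : ℕ) : (x + y).seq i = x.seq i + y.seq i := rfl

theorem seq_sub (x y : LorentzPredual w) (i : ℕ) : (x - y).seq i = x.seq i - y.seq i := rfl

theorem seq_smul (c : ℂ) (x : LorentzPredual w) (i : ℕ) : (c • x).seq i = c * x.seq i := rfl

theorem ext_seq {x y : LorentzPredual w} (h : ∀ i, x.seq i = y.seq i) : x = y :=
  Subtype.ext (funext h)

theorem sum_norm_le (x : LorentzPredual w) (A : Finset ℕ) :
    ∑ i ∈ A, ‖x.seq i‖ ≤ ‖x‖ * w.partialSum A.card := by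
  rcases Nat.eq_zero_or_pos A.card with h0 | h0
  · rw [Finset.card_eq_zero.mp h0]; simp [AdmissibleSeq.partialSum_zero]
  · obtain ⟨n, hn⟩ : ∃ n, A.card = n + 1 := ⟨A.card - 1, by omega⟩
    have h1 := sum_norm_le_rearrangedSum x.bddAbove_seq A
    have h2 := x.ratio_le_lorentzNorm n
    rw [div_le_iff₀ (w.partialSum_pos n), ← hn] at h2
    exact h1.trans h2

/-- Frees all later norm estimates from the decreasing rearrangement, whose partial sums are
approximated by sums of moduli over finite sets. -/
theorem norm_le_iff {x : LorentzPredual w} {c : ℝ} :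
    ‖x‖ ≤ c ↔ ∀ A : Finset ℕ, ∑ i ∈ A, ‖x.seq i‖ ≤ c * w.partialSum A.card := by
  refine ⟨fun h A => (x.sum_norm_le A).trans
    (mul_le_mul_of_nonneg_right h (w.partialSum_nonneg _)), fun h => ?_⟩
  refine ciSup_le fun n => ?_
  rw [div_le_iff₀ (w.partialSum_pos n)]
  exact rearrangedSum_le_of_forall fun A hA => hA ▸ h A

theorem norm_seq_le (x : LorentzPredual w) (i : ℕ) : ‖x.seq i‖ ≤ ‖x‖ :=
  x.norm_seq_le_lorentzNorm i

theorem exists_sum_norm_le (x : LorentzPredual w) {ε : ℝ} (hε : 0 < ε) :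
    ∃ m : ℕ, ∀ A : Finset ℕ, m ≤ A.card → ∑ i ∈ A, ‖x.seq i‖ ≤ ε * w.partialSum A.card := by
  obtain ⟨m, hm⟩ := eventually_atTop.mp (x.tendsto_ratio.eventually_lt_const hε)
  refine ⟨m + 1, fun A hA => ?_⟩
  obtain ⟨n, hn⟩ : ∃ n, A.card = n + 1 := ⟨A.card - 1, by omega⟩
  have h1 := sum_norm_le_rearrangedSum x.bddAbove_seq A
  have h2 := (hm n (by omega)).le
  rw [div_le_iff₀ (w.partialSum_pos n), ← hn] at h2
  exact h1.trans h2

/-- The element with a given underlying sequence, from estimates on finite sums of moduli. -/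
def ofSeq (w : AdmissibleSeq) (x : ℕ → ℂ) (M : ℝ) (hM : ∀ i, ‖x i‖ ≤ M)
    (hx : ∀ ε : ℝ, 0 < ε → ∃ m : ℕ, ∀ A : Finset ℕ, m ≤ A.card →
      ∑ i ∈ A, ‖x i‖ ≤ ε * w.partialSum A.card) : LorentzPredual w :=
  ⟨x, ⟨M, by rintro _ ⟨i, rfl⟩; exact hM i⟩, by
    rw [Metric.tendsto_atTop]
    intro ε hε
    obtain ⟨m, hm⟩ := hx (ε / 2) (by positivity)
    refine ⟨m + 1, fun n hn => ?_⟩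
    have hpos : 0 < w.partialSum n := by
      obtain ⟨k, rfl⟩ : ∃ k, n = k + 1 := ⟨n - 1, by omega⟩
      exact w.partialSum_pos k
    have h1 : rearrangedSum x n / w.partialSum n ≤ ε / 2 := by
      rw [div_le_iff₀ hpos]
      exact rearrangedSum_le_of_forall fun A hA => hA ▸ hm A (by omega)
    rw [Real.dist_0_eq_abs, abs_of_nonneg (div_nonneg (rearrangedSum_nonneg _ _) hpos.le)]
    linarith⟩

/-- The element with a given finitely supported underlying sequence. -/
def ofFinset (w : AdmissibleSeq) (T : Finset ℕ) (c : ℕ → ℂ) : LorentzPredual w :=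
  ofSeq w (fun i => if i ∈ T then c i else 0) (∑ i ∈ T, ‖c i‖)
    (fun i => by
      split_ifs with h
      · exact Finset.single_le_sum (f := fun i => ‖c i‖) (fun _ _ => norm_nonneg _) h
      · rw [norm_zero]; exact Finset.sum_nonneg fun _ _ => norm_nonneg _)
    (fun ε hε => by
      obtain ⟨m, hm⟩ := eventually_atTop.mp
        (w.tendsto_partialSum.eventually_ge_atTop ((∑ i ∈ T, ‖c i‖) / ε))
      refine ⟨m, fun A hA => ?_⟩
      have h1 := hm _ hA
      rw [div_le_iff₀ hε] at h1
      have h2 : ∑ i ∈ A, ‖if i ∈ T then c i else 0‖ = ∑ i ∈ A ∩ T, ‖c i‖ := by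
        rw [← Finset.sum_ite_mem]
        exact Finset.sum_congr rfl fun i _ => by split_ifs <;> simp
      rw [h2]
      have h3 : ∑ i ∈ A ∩ T, ‖c i‖ ≤ ∑ i ∈ T, ‖c i‖ :=
        Finset.sum_le_sum_of_subset_of_nonneg Finset.inter_subset_right
          fun _ _ _ => norm_nonneg _
      linarith)

theorem seq_ofFinset (T : Finset ℕ) (c : ℕ → ℂ) (i : ℕ) :
    (ofFinset w T c).seq i = if i ∈ T then c i else 0 := rfl

theorem norm_mono {x y : LorentzPredual w} (h : ∀ i, ‖x.seq i‖ ≤ ‖y.seq i‖) : ‖x‖ ≤ ‖y‖ :=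
  norm_le_iff.mpr fun A => (Finset.sum_le_sum fun i _ => h i).trans (y.sum_norm_le A)

theorem norm_indicator_le (S : Set ℕ) (x : LorentzPredual w) (i : ℕ) :
    ‖S.indicator x.seq i‖ ≤ ‖x.seq i‖ := norm_indicator_le_norm_self _ _

/-- The restriction of sequences to a set of indices. -/
def restrict (S : Set ℕ) : LorentzPredual w →L[ℂ] LorentzPredual w :=
  LinearMap.mkContinuous
    { toFun := fun x => ofSeq w (S.indicator x.seq) ‖x‖
        (fun i => (norm_indicator_le S x i).trans (x.norm_seq_le i))
        (fun ε hε => (x.exists_sum_norm_le hε).imp fun _ hm A hA =>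
          (Finset.sum_le_sum fun i _ => norm_indicator_le S x i).trans (hm A hA))
      map_add' := fun x y => ext_seq fun i => congrFun (Set.indicator_add S x.seq y.seq) i
      map_smul' := fun c x => ext_seq fun i => congrFun (Set.indicator_const_smul S c x.seq) i }
    1 fun x => by
      rw [one_mul]
      exact norm_mono fun i => norm_indicator_le S x i

theorem seq_restrict (S : Set ℕ) (x : LorentzPredual w) (i : ℕ) :
    (restrict S x).seq i = S.indicator x.seq i := rfl

theorem norm_restrict_le (S : Set ℕ) (x : LorentzPredual w) : ‖restrict S x‖ ≤ ‖x‖ :=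
  norm_mono fun i => norm_indicator_le S x i

/-- The coordinate functionals. -/
def coord (i : ℕ) : LorentzPredual w →L[ℂ] ℂ :=
  LinearMap.mkContinuous
    { toFun := fun x => x.seq i
      map_add' := fun x y => seq_add x y i
      map_smul' := fun c x => seq_smul c x i }
    1 fun x => by
      rw [one_mul]
      exact x.norm_seq_le i

theorem coord_apply (i : ℕ) (x : LorentzPredual w) : coord i x = x.seq i := rfl

theorem seq_sum {ι : Type*} (s : Finset ι) (x : ι → LorentzPredual w) (i : ℕ) :
    (∑ k ∈ s, x k).seq i = ∑ k ∈ s, (x k).seq i := by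
  simp only [← coord_apply, map_sum]

/-- Elements of `d_*(w,1)` are null sequences. -/
theorem exists_norm_seq_le (x : LorentzPredual w) {ε : ℝ} (hε : 0 < ε) :
    ∃ n : ℕ, ∀ k, n ≤ k → ‖x.seq k‖ ≤ ε := by
  by_contra! hcon
  obtain ⟨m, hm⟩ := x.exists_sum_norm_le (half_pos hε)
  have hinf : {k | ε < ‖x.seq k‖}.Infinite :=
    Set.infinite_of_forall_exists_gt fun n => by
      obtain ⟨k, hk, hlt⟩ := hcon (n + 1)
      exact ⟨k, hlt, hk⟩
  obtain ⟨A, hA, hcard⟩ := hinf.exists_subset_card_eq (m + 1)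
  have h1 := hm A (by omega)
  have h2 : A.card • ε ≤ ∑ i ∈ A, ‖x.seq i‖ :=
    Finset.card_nsmul_le_sum _ _ _ fun i hi => (hA hi).le
  rw [nsmul_eq_mul] at h2
  have h3 := w.partialSum_le A.card
  have h4 : (0 : ℝ) < A.card := by rw [hcard]; positivity
  nlinarith

/-- Adding a vector with small coordinates is nearly like adding a vector in `c₀`. -/
theorem exists_norm_add_le (z : LorentzPredual w) (B : ℝ) {ε : ℝ} (hε : 0 < ε) :
    ∃ η : ℝ, 0 < η ∧ ∀ x : LorentzPredual w, ‖x‖ ≤ B → (∀ i, ‖x.seq i‖ ≤ η) →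
      ‖z + x‖ ≤ max ‖z‖ B + ε := by
  obtain ⟨m, hm⟩ := z.exists_sum_norm_le hε
  refine ⟨ε / (m + 1), by positivity, fun x hx hη => norm_le_iff.mpr fun A => ?_⟩
  have h1 : ∑ i ∈ A, ‖(z + x).seq i‖ ≤ ∑ i ∈ A, ‖z.seq i‖ + ∑ i ∈ A, ‖x.seq i‖ := by
    rw [← Finset.sum_add_distrib]
    exact Finset.sum_le_sum fun i _ => norm_add_le _ _
  have hW := w.partialSum_nonneg A.card
  rcases le_or_gt m A.card with hA | hA
  · have h2 := hm A hA
    have h3 := x.sum_norm_le A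
    have h4 : ‖x‖ * w.partialSum A.card ≤ max ‖z‖ B * w.partialSum A.card :=
      mul_le_mul_of_nonneg_right (hx.trans (le_max_right _ _)) hW
    linarith
  · rcases A.eq_empty_or_nonempty with rfl | hne
    · simp [AdmissibleSeq.partialSum_zero]
    · have h2 : ∑ i ∈ A, ‖x.seq i‖ ≤ A.card • (ε / (m + 1)) :=
        Finset.sum_le_card_nsmul _ _ _ fun i _ => hη i
      have h3 : A.card • (ε / (m + 1)) ≤ ε := by
        rw [nsmul_eq_mul, ← mul_div_assoc, div_le_iff₀ (by positivity)]
        have : (A.card : ℝ) ≤ m := by exact_mod_cast hA.le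
        nlinarith
      have h4 := z.sum_norm_le A
      have h5 : ‖z‖ * w.partialSum A.card ≤ max ‖z‖ B * w.partialSum A.card :=
        mul_le_mul_of_nonneg_right (le_max_left _ _) hW
      have h6 := w.one_le_partialSum (Finset.card_pos.mpr hne)
      nlinarith

/-- Small perturbations of far coordinates do not increase a positive bound on the norm. -/
theorem exists_norm_add_single_le {s : ℝ} (hs : 0 < s) {x : LorentzPredual w} (hx : ‖x‖ ≤ s) :
    ∃ (k : ℕ) (δ : ℝ), 0 < δ ∧ ∀ t : ℂ, ‖t‖ ≤ δ → ‖x + t • ofFinset w {k} 1‖ ≤ s := by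
  obtain ⟨m, hm⟩ := x.exists_sum_norm_le (half_pos hs)
  -- If `A` has more than `m` indices, the sum over `A` is at most `s / 2 * W`, which leaves room
  -- for `δ ≤ s / 2`. If `A` contains `k` and has `n + 1 ≤ m` indices, the one at `k` contributes at
  -- most `2 * δ = s * w m ≤ s * w n`.
  set δ := s * w m / 2 with hδ
  have hwm := w.pos m
  have hδ0 : 0 < δ := by positivity
  obtain ⟨k, hk⟩ := x.exists_norm_seq_le hδ0
  refine ⟨k, δ, hδ0, fun t ht => norm_le_iff.mpr fun A => ?_⟩
  have hseq : ∀ i, (x + t • ofFinset w {k} 1).seq i = x.seq i + if i = k then t else 0 := by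
    intro i
    rw [seq_add, seq_smul, seq_ofFinset]
    simp
  by_cases hkA : k ∈ A
  · have h1 : ∑ i ∈ A, ‖(x + t • ofFinset w {k} 1).seq i‖
        = ∑ i ∈ A.erase k, ‖x.seq i‖ + ‖x.seq k + t‖ := by
      rw [← Finset.sum_erase_add _ _ hkA, hseq, if_pos rfl]
      congr 1
      refine Finset.sum_congr rfl fun i hi => ?_
      rw [hseq, if_neg (Finset.ne_of_mem_erase hi), add_zero]
    have h2 : ‖x.seq k + t‖ ≤ ‖x.seq k‖ + ‖t‖ := norm_add_le _ _
    obtain ⟨n, hn⟩ : ∃ n, A.card = n + 1 := ⟨A.card - 1, by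
      have := Finset.card_pos.mpr ⟨k, hkA⟩; omega⟩
    have hcard : (A.erase k).card = n := by rw [Finset.card_erase_of_mem hkA]; omega
    rw [h1]
    rcases le_or_gt m n with hmn | hmn
    · have h3 : ∑ i ∈ A.erase k, ‖x.seq i‖ + ‖x.seq k‖ ≤ s / 2 * w.partialSum A.card := by
        rw [Finset.sum_erase_add _ _ hkA]
        exact hm A (by omega)
      have h4 := w.one_le_partialSum (n := A.card) (by omega)
      have h5 := w.le_one m
      nlinarith
    · have h3 := (norm_le_iff.mp hx) (A.erase k)
      have h4 := hk k le_rfl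
      have h5 : w m ≤ w n := w.antitone hmn.le
      rw [hcard] at h3
      rw [hn, AdmissibleSeq.partialSum_succ]
      nlinarith
  · have h1 : ∑ i ∈ A, ‖(x + t • ofFinset w {k} 1).seq i‖ = ∑ i ∈ A, ‖x.seq i‖ :=
      Finset.sum_congr rfl fun i hi => by
        rw [hseq, if_neg (ne_of_mem_of_not_mem hi hkA), add_zero]
    rw [h1]
    exact (norm_le_iff.mp hx) A

end LorentzPredual

/-! ### Weak majorization and sums of powers. -/

section Majorization

/-- Convexity of the power: its graph lies above the tangent at `a`. Multiplying the previous case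
by `b` leaves the excess `(n + 1) * a ^ n * (b - a) ^ 2`. -/
theorem pow_tangent_le {a b : ℝ} (ha : 0 ≤ a) (hb : 0 ≤ b) (n : ℕ) :
    a ^ (n + 1) + (n + 1) * a ^ n * (b - a) ≤ b ^ (n + 1) := by
  induction n with
  | zero => simp
  | succ n ih =>
    have h1 := mul_le_mul_of_nonneg_left ih hb
    have h2 : 0 ≤ (n + 1) * a ^ n * (b - a) ^ 2 := by positivity
    push_cast
    have e : b * (a ^ (n + 1) + (n + 1) * a ^ n * (b - a)) -
        (a ^ (n + 1 + 1) + (n + 1 + 1) * a ^ (n + 1) * (b - a))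
        = (n + 1) * a ^ n * (b - a) ^ 2 := by ring
    have e2 : b ^ (n + 1 + 1) = b * b ^ (n + 1) := by ring
    linarith

/-- Abel summation. Keeping `c n` times the full sum on the right makes the induction work: lowering
the factor of a nonpositive sum increases the product. -/
theorem sum_mul_le_of_antitone {c d : ℕ → ℝ} (hc : Antitone c)
    (hd : ∀ k, ∑ i ∈ Finset.range k, d i ≤ 0) (n : ℕ) :
    ∑ i ∈ Finset.range (n + 1), c i * d i ≤ c n * ∑ i ∈ Finset.range (n + 1), d i := by
  induction n with
  | zero => simp
  | succ n ih =>
    rw [Finset.sum_range_succ, Finset.sum_range_succ _ (n + 1), mul_add]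
    have h1 := mul_le_mul_of_nonpos_right (hc (Nat.le_succ n)) (hd (n + 1))
    have h2 : c (n + 1) = c n.succ := rfl
    linarith

/-- Sums of powers are monotone under weak majorization of a decreasing sequence. -/
theorem sum_pow_le_sum_pow {a b : ℕ → ℝ} (ha : ∀ i, 0 ≤ a i) (hb : ∀ i, 0 ≤ b i)
    (hanti : Antitone a)
    (hab : ∀ k, ∑ i ∈ Finset.range k, a i ≤ ∑ i ∈ Finset.range k, b i) (N n : ℕ) :
    ∑ i ∈ Finset.range n, a i ^ (N + 1) ≤ ∑ i ∈ Finset.range n, b i ^ (N + 1) := by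
  rcases n with _ | n
  · simp
  have hc : Antitone fun i => a i ^ N := fun i j hij => by
    have := hanti hij
    have := ha j
    dsimp only
    gcongr
  have h1 := sum_mul_le_of_antitone (d := fun i => a i - b i) hc (fun k => by
    rw [Finset.sum_sub_distrib]; linarith [hab k]) n
  have h2 : a n ^ N * ∑ i ∈ Finset.range (n + 1), (a i - b i) ≤ 0 := by
    apply mul_nonpos_of_nonneg_of_nonpos (pow_nonneg (ha n) _)
    rw [Finset.sum_sub_distrib]; linarith [hab (n + 1)]
  have h3 : ∑ i ∈ Finset.range (n + 1), (a i ^ (N + 1) - b i ^ (N + 1))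
      ≤ ∑ i ∈ Finset.range (n + 1), (N + 1) * (a i ^ N * (a i - b i)) :=
    Finset.sum_le_sum fun i _ => by
      have := pow_tangent_le (ha i) (hb i) N
      linarith
  rw [← Finset.mul_sum, Finset.sum_sub_distrib] at h3
  have h4 : ((N : ℝ) + 1) * ∑ i ∈ Finset.range (n + 1), a i ^ N * (a i - b i) ≤ 0 :=
    mul_nonpos_of_nonneg_of_nonpos (by positivity) (h1.trans h2)
  linarith

theorem decreasingRearrangement_set_nonempty {x : ℕ → ℂ}
    (hx : BddAbove (Set.range fun j => ‖x j‖)) (n : ℕ) :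
    {t : ℝ | 0 ≤ t ∧ {j : ℕ | t < ‖x j‖}.encard ≤ n}.Nonempty := by
  obtain ⟨M, hM⟩ := hx
  refine ⟨max M 0, le_max_right _ _, ?_⟩
  have : {j : ℕ | max M 0 < ‖x j‖} = ∅ := by
    ext k
    simp only [Set.mem_ofPred_eq, Set.mem_empty_iff_false, iff_false, not_lt]
    exact (hM ⟨k, rfl⟩).trans (le_max_left _ _)
  rw [this, Set.encard_empty]
  exact bot_le

theorem decreasingRearrangement_antitone {x : ℕ → ℂ}
    (hx : BddAbove (Set.range fun j => ‖x j‖)) : Antitone (decreasingRearrangement x) := by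
  intro m n hmn
  refine csInf_le_csInf ⟨0, fun t ht => ht.1⟩ (decreasingRearrangement_set_nonempty hx m) ?_
  rintro t ⟨h0, ht⟩
  exact ⟨h0, ht.trans (by exact_mod_cast hmn)⟩

theorem le_decreasingRearrangement {x : ℕ → ℂ} (hx : BddAbove (Set.range fun j => ‖x j‖))
    {A : Finset ℕ} {n : ℕ} (hA : A.card = n + 1) {r : ℝ} (hr : ∀ k ∈ A, r ≤ ‖x k‖) :
    r ≤ decreasingRearrangement x n := by
  apply le_csInf (decreasingRearrangement_set_nonempty hx n)
  rintro t ⟨-, ht⟩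
  by_contra! hlt
  have hsub : (A : Set ℕ) ⊆ {j : ℕ | t < ‖x j‖} := fun k hk => hlt.trans_le (hr k hk)
  have h3 := (Set.encard_le_encard hsub).trans ht
  rw [Set.encard_coe_eq_coe_finsetCard, hA] at h3
  have h4 : n + 1 ≤ n := by exact_mod_cast h3
  omega

theorem sum_norm_pow_le_decreasingRearrangement {x : ℕ → ℂ}
    (hx : BddAbove (Set.range fun j => ‖x j‖)) (N : ℕ) (A : Finset ℕ) :
    ∑ j ∈ A, ‖x j‖ ^ N ≤ ∑ i ∈ Finset.range A.card, decreasingRearrangement x i ^ N := by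
  induction hn : A.card generalizing A with
  | zero => simp [Finset.card_eq_zero.mp hn]
  | succ n ih =>
    have hne : A.Nonempty := Finset.card_pos.mp (by omega)
    obtain ⟨j, hj, hmin⟩ := A.exists_min_image (fun j => ‖x j‖) hne
    have h1 := ih (A.erase j) (by rw [Finset.card_erase_of_mem hj]; omega)
    have h2 := le_decreasingRearrangement hx hn hmin
    rw [← Finset.sum_erase_add _ _ hj, Finset.sum_range_succ]
    gcongr

end Majorization

/-! ### The power sum form for `w ∈ ℓ_N`. -/

namespace LorentzPredual

variable {w : AdmissibleSeq}

/-- The rearrangement of `x` is decreasing and its partial sums are at most those of `‖x‖ * w i`, so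
`sum_pow_le_sum_pow` applies. -/
theorem sum_norm_pow_le {N : ℕ} (hN : 1 ≤ N) (hw : Summable fun i => w i ^ N)
    (x : LorentzPredual w) (A : Finset ℕ) :
    ∑ i ∈ A, ‖x.seq i‖ ^ N ≤ ‖x‖ ^ N * ∑' i, w i ^ N := by
  obtain ⟨n, rfl⟩ : ∃ n, N = n + 1 := ⟨N - 1, by omega⟩
  refine (sum_norm_pow_le_decreasingRearrangement x.bddAbove_seq _ A).trans ?_
  refine (sum_pow_le_sum_pow (b := fun i => ‖x‖ * w i) (decreasingRearrangement_nonneg _)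
    (fun i => mul_nonneg (norm_nonneg _) (w.nonneg i))
    (decreasingRearrangement_antitone x.bddAbove_seq) (fun k => ?_) n A.card).trans ?_
  · rw [← Finset.mul_sum]
    exact rearrangedSum_le_of_forall fun A hA => hA ▸ x.sum_norm_le A
  · simp only [mul_pow]
    rw [← Finset.mul_sum]
    gcongr
    exact hw.sum_le_tsum _ fun i _ => pow_nonneg (w.nonneg i) _

theorem summable_norm_pow {N : ℕ} (hN : 1 ≤ N) (hw : Summable fun i => w i ^ N)
    (x : LorentzPredual w) : Summable fun i => ‖x.seq i‖ ^ N :=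
  summable_of_sum_le (fun _ => by positivity) (x.sum_norm_pow_le hN hw)

theorem tsum_norm_pow_le {N : ℕ} (hN : 1 ≤ N) (hw : Summable fun i => w i ^ N)
    (x : LorentzPredual w) : ∑' i, ‖x.seq i‖ ^ N ≤ ‖x‖ ^ N * ∑' i, w i ^ N :=
  (x.summable_norm_pow hN hw).tsum_le_of_sum_le (x.sum_norm_pow_le hN hw)

theorem norm_prod_seq_le {N : ℕ} (hN : 1 ≤ N) (m : Fin N → LorentzPredual w) (i : ℕ) :
    ‖∏ k, (m k).seq i‖ ≤ ∑ k, ‖(m k).seq i‖ ^ N := by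
  have : Nonempty (Fin N) := ⟨⟨0, hN⟩⟩
  obtain ⟨k₀, hk₀⟩ := Finite.exists_max fun k => ‖(m k).seq i‖
  rw [norm_prod]
  calc ∏ k, ‖(m k).seq i‖ ≤ ∏ _k : Fin N, ‖(m k₀).seq i‖ :=
        Finset.prod_le_prod (fun _ _ => norm_nonneg _) fun k _ => hk₀ k
    _ = ‖(m k₀).seq i‖ ^ N := by simp
    _ ≤ _ := Finset.single_le_sum (f := fun k => ‖(m k).seq i‖ ^ N)
        (fun _ _ => by positivity) (Finset.mem_univ k₀)

theorem summable_prod_seq {N : ℕ} (hN : 1 ≤ N) (hw : Summable fun i => w i ^ N)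
    (m : Fin N → LorentzPredual w) : Summable fun i => ∏ k, (m k).seq i :=
  Summable.of_norm_bounded (summable_sum fun k _ => (m k).summable_norm_pow hN hw)
    (norm_prod_seq_le hN m)

/-- The multilinear form `(x₁, …, x_N) ↦ ∑ᵢ x₁(i) ⋯ x_N(i)`. -/
def powerSumMultilinear {N : ℕ} (hN : 1 ≤ N) (hw : Summable fun i => w i ^ N) :
    MultilinearMap ℂ (fun _ : Fin N => LorentzPredual w) ℂ where
  toFun m := ∑' i, ∏ k, (m k).seq i
  map_update_add' m k x y := by
    rw [← (summable_prod_seq hN hw _).tsum_add (summable_prod_seq hN hw _)]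
    exact tsum_congr fun i => ((MultilinearMap.mkPiAlgebra ℂ (Fin N) ℂ).compLinearMap
      fun _ => (coord (w := w) i).toLinearMap).map_update_add m k x y
  map_update_smul' m k c x := by
    rw [smul_eq_mul, ← tsum_mul_left]
    exact tsum_congr fun i => ((MultilinearMap.mkPiAlgebra ℂ (Fin N) ℂ).compLinearMap
      fun _ => (coord (w := w) i).toLinearMap).map_update_smul m k c x

theorem norm_powerSumMultilinear_le {N : ℕ} (hN : 1 ≤ N) (hw : Summable fun i => w i ^ N)
    (m : Fin N → LorentzPredual w) :
    ‖powerSumMultilinear hN hw m‖ ≤ (N * (∑' i, w i ^ N) * 2 ^ N) * ∏ k, ‖m k‖ := by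
  set S := ∑' i, w i ^ N with hS
  have hS0 : 0 ≤ S := tsum_nonneg fun i => pow_nonneg (w.nonneg i) _
  -- Multilinearity allows all norms to be taken in `[1/2, 1)`: the power sums are then at most `S`
  -- each, and the lower bound on the norms costs the factor `2 ^ N`.
  refine MultilinearMap.bound_of_shell _ (ε := fun _ => 1) (c := fun _ => 2)
    (fun _ => one_pos) (fun _ => by simp) (fun m h1 h2 => ?_) m
  have e1 : ‖powerSumMultilinear hN hw m‖ ≤ ∑' i, ∑ k, ‖(m k).seq i‖ ^ N :=
    tsum_of_norm_bounded (summable_sum fun k _ => (m k).summable_norm_pow hN hw).hasSum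
      (norm_prod_seq_le hN m)
  have e2 : ∑' i, ∑ k, ‖(m k).seq i‖ ^ N ≤ N * S := by
    rw [Summable.tsum_finsetSum fun k _ => (m k).summable_norm_pow hN hw]
    calc ∑ k, ∑' i, ‖(m k).seq i‖ ^ N ≤ ∑ _k : Fin N, S :=
          Finset.sum_le_sum fun k _ => ((m k).tsum_norm_pow_le hN hw).trans
            (mul_le_of_le_one_left hS0 (pow_le_one₀ (norm_nonneg _) (h2 k).le))
      _ = N * S := by simp
  have e3 : (1 : ℝ) ≤ 2 ^ N * ∏ k, ‖m k‖ := by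
    have : ∏ _k : Fin N, (1 / 2 : ℝ) ≤ ∏ k, ‖m k‖ :=
      Finset.prod_le_prod (fun _ _ => by norm_num) fun k _ => by simpa using h1 k
    rw [Finset.prod_const, Finset.card_univ, Fintype.card_fin] at this
    calc (1 : ℝ) = 2 ^ N * (1 / 2) ^ N := by rw [← mul_pow]; norm_num
      _ ≤ _ := by gcongr
  calc _ ≤ N * S := e1.trans e2
    _ ≤ N * S * (2 ^ N * ∏ k, ‖m k‖) := le_mul_of_one_le_right (by positivity) e3
    _ = _ := by ring

/-- The bounded multilinear form `(x₁, …, x_N) ↦ ∑ᵢ x₁(i) ⋯ x_N(i)`. -/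
def powerSum {N : ℕ} (hN : 1 ≤ N) (hw : Summable fun i => w i ^ N) :
    ContinuousMultilinearMap ℂ (fun _ : Fin N => LorentzPredual w) ℂ :=
  (powerSumMultilinear hN hw).mkContinuous _ (norm_powerSumMultilinear_le hN hw)

theorem powerSum_apply {N : ℕ} (hN : 1 ≤ N) (hw : Summable fun i => w i ^ N)
    (x : LorentzPredual w) : powerSum hN hw (fun _ => x) = ∑' i, x.seq i ^ N := by
  show ∑' i, ∏ _k : Fin N, x.seq i = _
  simp

theorem powerSum_add_single {N : ℕ} (hN : 1 ≤ N) (hw : Summable fun i => w i ^ N)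
    (x : LorentzPredual w) (k : ℕ) (t : ℂ) :
    powerSum hN hw (fun _ => x + t • ofFinset w {k} 1)
      = powerSum hN hw (fun _ => x) - x.seq k ^ N + (x.seq k + t) ^ N := by
  have hs : ∀ y : LorentzPredual w, Summable fun i => y.seq i ^ N := fun y =>
    Summable.of_norm (by simpa only [norm_pow] using y.summable_norm_pow hN hw)
  rw [powerSum_apply, powerSum_apply, (hs _).tsum_eq_add_tsum_ite k,
    (hs x).tsum_eq_add_tsum_ite k]
  have hseq : ∀ i, (x + t • ofFinset w {k} 1).seq i = x.seq i + if i = k then t else 0 := by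
    intro i
    rw [seq_add, seq_smul, seq_ofFinset]
    simp
  have h1 : ∀ i, (if i = k then (0 : ℂ) else (x + t • ofFinset w {k} 1).seq i ^ N)
      = if i = k then 0 else x.seq i ^ N := by
    intro i
    split_ifs with h
    · rfl
    · rw [hseq, if_neg h, add_zero]
  rw [tsum_congr h1, hseq, if_pos rfl]
  ring

theorem norm_single_le (k : ℕ) : ‖ofFinset w {k} 1‖ ≤ 1 := by
  refine norm_le_iff.mpr fun A => ?_
  simp only [seq_ofFinset, Finset.mem_singleton, Pi.one_apply, one_mul]
  by_cases hk : k ∈ A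
  · rw [Finset.sum_eq_single_of_mem k hk (fun i _ hi => by simp [hi])]
    simpa using w.one_le_partialSum (Finset.card_pos.mpr ⟨k, hk⟩)
  · rw [Finset.sum_eq_zero fun i hi => by simp [ne_of_mem_of_not_mem hi hk]]
    exact w.partialSum_nonneg _

end LorentzPredual

/-! ### Failure of density when `w ∈ ℓ_N`. -/

namespace BallAlgebra

variable {X : Type*} [NormedAddCommGroup X] [NormedSpace ℂ X]

/-- The element of `A_u(X)` given by a function on `X`. -/
def ofFun (F : X → ℂ) (C : ℝ) (hC : ∀ x, ‖x‖ ≤ 1 → ‖F x‖ ≤ C)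
    (hu : UniformContinuous fun x : closedBall (0 : X) 1 => F x)
    (hd : DifferentiableOn ℂ F (ball 0 1)) : BallAlgebra X :=
  ⟨BoundedContinuousFunction.ofNormedAddCommGroup (fun x : closedBall (0 : X) 1 => F x)
    hu.continuous C (fun x => hC x (mem_closedBall_zero_iff.mp x.2)), hu, F, fun _ => rfl, hd⟩

theorem norm_le_normOn (s : ℝ) (f : BallAlgebra X) (x : closedBall (0 : X) 1)
    (hx : ‖(x : X)‖ ≤ s) : ‖f.1 x‖ ≤ normOn s f :=
  le_csSup ⟨‖f.1‖, by rintro _ ⟨y, -, rfl⟩; exact f.1.norm_coe_le_norm y⟩ ⟨x, hx, rfl⟩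

end BallAlgebra

theorem uniformContinuous_powerSum {w : AdmissibleSeq} {N : ℕ} (hN : 1 ≤ N)
    (hw : Summable fun i => w i ^ N) :
    UniformContinuous fun x : closedBall (0 : LorentzPredual w) 1 =>
      LorentzPredual.powerSum hN hw fun _ => x.1 := by
  set A := LorentzPredual.powerSum hN hw
  have hconst : ∀ y : LorentzPredual w, ‖(fun _ : Fin N => y)‖ ≤ ‖y‖ := fun y =>
    (pi_norm_le_iff_of_nonneg (norm_nonneg _)).mpr fun _ => le_rfl
  refine (LipschitzWith.of_dist_le_mul (K := (‖A‖ * N).toNNReal) fun x y => ?_).uniformContinuous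
  rw [Real.coe_toNNReal _ (by positivity), dist_eq_norm]
  have h := A.norm_image_sub_le (fun _ => x.1) (fun _ => y.1)
  rw [Fintype.card_fin] at h
  refine h.trans ?_
  have hx := mem_closedBall_zero_iff.mp x.2
  have hy := mem_closedBall_zero_iff.mp y.2
  have h1 : max ‖(fun _ : Fin N => x.1)‖ ‖(fun _ : Fin N => y.1)‖ ^ (N - 1) ≤ 1 :=
    pow_le_one₀ (le_max_of_le_left (norm_nonneg _))
      (max_le ((hconst _).trans hx) ((hconst _).trans hy))
  have h2 : ‖(fun _ : Fin N => x.1) - (fun _ : Fin N => y.1)‖ ≤ dist x y := by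
    rw [Subtype.dist_eq, dist_eq_norm]
    exact hconst (x.1 - y.1)
  calc _ ≤ ‖A‖ * N * 1 * dist x y := by gcongr
    _ = _ := by ring

theorem differentiable_powerSum {w : AdmissibleSeq} {N : ℕ} (hN : 1 ≤ N)
    (hw : Summable fun i => w i ^ N) :
    Differentiable ℂ fun x : LorentzPredual w => LorentzPredual.powerSum hN hw fun _ => x :=
  ((LorentzPredual.powerSum hN hw).contDiff (n := 1)).differentiable one_ne_zero |>.comp
    (differentiable_pi.mpr fun _ => differentiable_id)

theorem not_dense_attainsNormOn {w : AdmissibleSeq} {s : ℝ} (hs0 : 0 < s) (hs1 : s < 1)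
    {N : ℕ} (hN : 1 ≤ N) (hw : Summable fun i => w i ^ N) :
    ¬ Dense {f : BallAlgebra (LorentzPredual w) | BallAlgebra.AttainsNormOn s f} := by
  intro hdense
  set A := LorentzPredual.powerSum hN hw with hA
  have hconst : ∀ y : LorentzPredual w, ‖(fun _ : Fin N => y)‖ ≤ ‖y‖ := fun y =>
    (pi_norm_le_iff_of_nonneg (norm_nonneg _)).mpr fun _ => le_rfl
  set p : BallAlgebra (LorentzPredual w) := BallAlgebra.ofFun (fun x => A fun _ => x) ‖A‖
    (fun x hx => by
      have := A.le_opNorm_mul_pow_card_of_le ((hconst x).trans hx)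
      simpa using this)
    (uniformContinuous_powerSum hN hw) (differentiable_powerSum hN hw).differentiableOn with hp
  -- As `s + ρ < 1`, the closed disc of radius `ρ` around `x₀` in the direction `e` lies in the open
  -- unit ball.
  set ρ := (1 - s) / 2 with hρ
  have hρ0 : 0 < ρ := by rw [hρ]; linarith
  obtain ⟨h, ⟨x₀, hx₀, hatt⟩, hdist⟩ := hdense.exists_dist_lt p (ε := ρ ^ N) (by positivity)
  obtain ⟨-, H, hH, hHd⟩ := h.2
  obtain ⟨k, δ, hδ, hk⟩ := LorentzPredual.exists_norm_add_single_le hs0 hx₀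
  set e := LorentzPredual.ofFinset w {k} 1
  have he : ‖e‖ ≤ 1 := LorentzPredual.norm_single_le k
  have hnorm : ∀ t : ℂ, ‖x₀.1 + t • e‖ ≤ s + ‖t‖ := fun t => by
    refine (norm_add_le _ _).trans (add_le_add hx₀ ?_)
    rw [norm_smul]
    exact mul_le_of_le_one_right (norm_nonneg _) he
  have hmaps : ∀ t ∈ ball (0 : ℂ) (1 - s), x₀.1 + t • e ∈ ball (0 : LorentzPredual w) 1 := by
    intro t ht
    rw [mem_ball_zero_iff] at ht ⊢
    linarith [hnorm t]
  set φ : ℂ → ℂ := fun t => H (x₀.1 + t • e) with hφ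
  have hφd : DifferentiableOn ℂ φ (ball 0 (1 - s)) :=
    hHd.comp (by fun_prop) hmaps
  have hball : ball (0 : ℂ) (1 - s) ∈ 𝓝 0 := ball_mem_nhds _ (by linarith)
  have hmax : IsLocalMax (norm ∘ φ) 0 := by
    filter_upwards [ball_mem_nhds (0 : ℂ) hδ, hball] with t ht1 ht2
    rw [mem_ball_zero_iff] at ht1
    have hmem : x₀.1 + t • e ∈ closedBall (0 : LorentzPredual w) 1 :=
      ball_subset_closedBall (hmaps t ht2)
    simp only [hφ, Function.comp, zero_smul, add_zero]
    rw [hH ⟨_, hmem⟩, hH x₀, hatt]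
    exact BallAlgebra.norm_le_normOn s h ⟨_, hmem⟩ (hk t ht1.le)
  have hev := Complex.eventually_eq_of_isLocalMax_norm
    (by filter_upwards [isOpen_ball.mem_nhds (mem_ball_self (x := (0 : ℂ))
          (by linarith : (0 : ℝ) < 1 - s))] with t ht
        exact hφd.differentiableAt (isOpen_ball.mem_nhds ht)) hmax
  set g : ℂ → ℂ := fun t => φ t - A fun _ => x₀.1 + t • e with hg
  -- Near `0` the function `φ` is constant, and only the summand `(x₀ k + t) ^ N` of the power sum
  -- depends on `t`.
  have hder : iteratedDeriv N g 0 = -(N.factorial : ℂ) := by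
    have h1 : g =ᶠ[𝓝 0] fun t => (φ 0 - ((A fun _ => x₀.1) - x₀.1.seq k ^ N))
        - (x₀.1.seq k + t) ^ N := by
      filter_upwards [hev] with t ht
      simp only [hg]
      rw [ht, hA, LorentzPredual.powerSum_add_single]
      ring
    rw [h1.iteratedDeriv_eq, iteratedDeriv_const_sub hN, iteratedDeriv_neg,
      iteratedDeriv_comp_const_add N (fun z : ℂ => z ^ N)]
    simp [iteratedDeriv_pow, Nat.descFactorial_self]
  have hgd : DiffContOnCl ℂ g (ball 0 ρ) := by
    apply DifferentiableOn.diffContOnCl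
    refine DifferentiableOn.mono ?_
      (closure_ball_subset_closedBall.trans (closedBall_subset_ball (by linarith : ρ < 1 - s)))
    refine hφd.sub (Differentiable.differentiableOn ?_)
    exact (differentiable_powerSum hN hw).comp (by fun_prop)
  have hest := Complex.norm_iteratedDeriv_le_of_forall_mem_sphere_norm_le N hρ0 hgd
    (C := dist p h) (fun t ht => by
      rw [mem_sphere_zero_iff_norm] at ht
      have hmem : x₀.1 + t • e ∈ closedBall (0 : LorentzPredual w) 1 := by
        rw [mem_closedBall_zero_iff]
        linarith [hnorm t]
      have h1 := BoundedContinuousFunction.dist_coe_le_dist (f := p.1) (g := h.1) ⟨_, hmem⟩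
      rw [dist_comm, dist_eq_norm, ← hH ⟨_, hmem⟩] at h1
      exact h1)
  rw [hder, norm_neg, Complex.norm_natCast, le_div_iff₀ (by positivity)] at hest
  have hfac : (0 : ℝ) < N.factorial := by positivity
  exact absurd (le_of_mul_le_mul_left hest hfac) (not_le.mpr hdist)

/-! ### Homogeneous functions on nearly null vectors. -/

namespace LorentzPredual

variable {w : AdmissibleSeq}

theorem sum_norm_le_of_card {T : Finset ℕ} {K : ℕ} (hT : T.card ≤ K) {B : ℝ} (hB : 0 ≤ B)
    {y : LorentzPredual w} (hy : ∀ i ∉ T, y.seq i = 0) (hyB : ∀ i, ‖y.seq i‖ ≤ B)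
    (A : Finset ℕ) : ∑ i ∈ A, ‖y.seq i‖ ≤ K * B := by
  have h1 : ∑ i ∈ A, ‖y.seq i‖ ≤ ∑ i ∈ A ∪ T, ‖y.seq i‖ :=
    Finset.sum_le_sum_of_subset_of_nonneg Finset.subset_union_left fun _ _ _ => norm_nonneg _
  have h2 : ∑ i ∈ A ∪ T, ‖y.seq i‖ = ∑ i ∈ T, ‖y.seq i‖ :=
    (Finset.sum_subset Finset.subset_union_right fun i _ hi => by rw [hy i hi, norm_zero]).symm
  have h3 : ∑ i ∈ T, ‖y.seq i‖ ≤ T.card • B := Finset.sum_le_card_nsmul _ _ _ fun i _ => hyB i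
  rw [nsmul_eq_mul] at h3
  have h4 : (T.card : ℝ) * B ≤ K * B := by gcongr
  linarith

theorem norm_le_of_card {T : Finset ℕ} {K : ℕ} (hT : T.card ≤ K) {B : ℝ} (hB : 0 ≤ B)
    {y : LorentzPredual w} (hy : ∀ i ∉ T, y.seq i = 0) (hyB : ∀ i, ‖y.seq i‖ ≤ B) :
    ‖y‖ ≤ K * B := by
  refine norm_le_iff.mpr fun A => ?_
  rcases A.eq_empty_or_nonempty with rfl | hne
  · simp [AdmissibleSeq.partialSum_zero]
  · exact (sum_norm_le_of_card hT hB hy hyB A).trans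
      (le_mul_of_one_le_right (by positivity) (w.one_le_partialSum (Finset.card_pos.mpr hne)))

/-- Vectors that are the sum of a bounded vector supported by at most `K` indices `≥ n` and of a
bounded vector with coordinates of modulus at most `1 / (n + 1)`. -/
structure NearlyNull (K : ℕ) (B : ℝ) (n : ℕ) (T : Finset ℕ) (y x : LorentzPredual w) : Prop where
  card_le : T.card ≤ K
  le_of_mem : ∀ i ∈ T, n ≤ i
  seq_eq_zero : ∀ i ∉ T, y.seq i = 0
  norm_seq_le : ∀ i, ‖y.seq i‖ ≤ B
  norm_le : ‖x‖ ≤ B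
  small : ∀ i, ‖x.seq i‖ ≤ 1 / (n + 1)

theorem NearlyNull.norm_add_le {K : ℕ} {B : ℝ} {n : ℕ} {T : Finset ℕ} {y x : LorentzPredual w}
    (h : NearlyNull K B n T y x) : ‖y + x‖ ≤ K * B + B :=
  (_root_.norm_add_le _ _).trans (add_le_add
    (norm_le_of_card h.card_le ((norm_nonneg _).trans h.norm_le) h.seq_eq_zero h.norm_seq_le)
    h.norm_le)

/-- The estimate that makes `∑ⱼ w j • yⱼ` bounded for disjoint `yⱼ` with few coordinates. -/
theorem sum_norm_add_smul_le {K : ℕ} {B : ℝ} (hB : 0 ≤ B) {J N : ℕ} {Y y : LorentzPredual w}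
    (hYN : ∀ i, N ≤ i → Y.seq i = 0)
    (hY : ∀ A : Finset ℕ, ∑ i ∈ A, ‖Y.seq i‖ ≤ K * B * w.partialSum (min J A.card))
    {T : Finset ℕ} (hT : T.card ≤ K) (hTN : ∀ i ∈ T, N ≤ i) (hy : ∀ i ∉ T, y.seq i = 0)
    (hyB : ∀ i, ‖y.seq i‖ ≤ B) {c : ℂ} (hc : ‖c‖ ≤ w J) (A : Finset ℕ) :
    ∑ i ∈ A, ‖(Y + c • y).seq i‖ ≤ K * B * w.partialSum (min (J + 1) A.card) := by
  have hKB : 0 ≤ (K : ℝ) * B := by positivity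
  have e0 : ∀ i ∈ A \ T, ‖(Y + c • y).seq i‖ = ‖Y.seq i‖ := fun i hi => by
    rw [seq_add, seq_smul, hy i (Finset.mem_sdiff.mp hi).2, mul_zero, add_zero]
  have e1 : ∀ i ∈ A ∩ T, ‖(Y + c • y).seq i‖ ≤ ‖c‖ * ‖y.seq i‖ := fun i hi => by
    rw [seq_add, seq_smul, hYN i (hTN i (Finset.mem_inter.mp hi).2), zero_add, norm_mul]
  rw [← Finset.sum_inter_add_sum_sdiff A T, Finset.sum_congr rfl e0]
  have h1 := hY (A \ T)
  rcases (A ∩ T).eq_empty_or_nonempty with h0 | hne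
  · rw [h0, Finset.sum_empty, zero_add]
    refine h1.trans (mul_le_mul_of_nonneg_left (w.partialSum_mono ?_) hKB)
    have := Finset.card_le_card (Finset.sdiff_subset (s := A) (t := T))
    omega
  · have hcard : (A \ T).card + 1 ≤ A.card := by
      have := Finset.card_sdiff_add_card_inter A T
      have := Finset.card_pos.mpr hne
      omega
    have h2 : ∑ i ∈ A ∩ T, ‖(Y + c • y).seq i‖ ≤ w J * (K * B) := by
      refine (Finset.sum_le_sum e1).trans ?_
      rw [← Finset.mul_sum]
      exact mul_le_mul hc (sum_norm_le_of_card hT hB hy hyB _)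
        (Finset.sum_nonneg fun _ _ => norm_nonneg _) (w.nonneg J)
    -- Since `A` meets `T`, passing to `A \ T` loses an index and frees one weight: `w J` itself, or
    -- an earlier and hence larger one when `A \ T` has fewer than `J` elements.
    have h3 : w.partialSum (min J (A \ T).card) + w J ≤ w.partialSum (min (J + 1) A.card) := by
      rcases le_or_gt J (A \ T).card with h | h
      · rw [min_eq_left h, min_eq_left (by omega), AdmissibleSeq.partialSum_succ]
      · rw [min_eq_right h.le]
        have h4 : w J ≤ w (A \ T).card := w.antitone h.le
        have h5 := w.partialSum_succ (A \ T).card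
        have h6 : w.partialSum ((A \ T).card + 1) ≤ w.partialSum (min (J + 1) A.card) :=
          w.partialSum_mono (by omega)
        linarith
    nlinarith [mul_le_mul_of_nonneg_left h3 hKB]

/-- The bad vectors are summed greedily with coefficients of modulus `w j` and phases that make
`|q|` grow by `ε * w j ^ m` each time. The few-coordinate parts are disjoint and their sum `Y` has
norm at most `K * B`; the small parts add nearly as in `c₀` to a sum `Z` of norm below `2 * B`.
Boundedness of `q` then makes `w ^ m` summable. -/
theorem not_forall_exists_nearlyNull {m : ℕ} (hm : 1 ≤ m) {q : LorentzPredual w → ℂ}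
    (hq : HomEntire m q) (hw : ¬ Summable fun i => w i ^ m) (K : ℕ) {B ε : ℝ} (hB : 0 < B)
    (hε : 0 < ε) (hbad : ∀ n₀ : ℕ, ∃ n ≥ n₀, ∃ T y x, NearlyNull K B n T y x ∧ ε ≤ ‖q (y + x)‖) :
    False := by
  have claim : ∀ J : ℕ, ∃ (N : ℕ) (Y Z : LorentzPredual w), (∀ i, N ≤ i → Y.seq i = 0) ∧
      (∀ A : Finset ℕ, ∑ i ∈ A, ‖Y.seq i‖ ≤ K * B * w.partialSum (min J A.card)) ∧
      ‖Z‖ < 2 * B ∧ ε * ∑ j ∈ Finset.range J, w j ^ m ≤ ‖q (Y + Z)‖ := by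
    intro J
    induction J with
    | zero =>
      refine ⟨0, 0, 0, fun i _ => rfl, fun A => ?_, ?_, ?_⟩
      · simp [seq_zero, AdmissibleSeq.partialSum_zero]
      · rw [norm_zero]; positivity
      · simp
    | succ J ih =>
      obtain ⟨N, Y, Z, hYN, hY, hZ, hle⟩ := ih
      have hmax : max ‖Z‖ B < 2 * B := max_lt hZ (by linarith)
      -- Only half of the remaining gap below `2 * B` is spent, so the strict bound survives the
      -- induction.
      obtain ⟨η, hη, hadd⟩ := Z.exists_norm_add_le B (half_pos (sub_pos.mpr hmax))
      obtain ⟨n₁, hn₁⟩ := exists_nat_one_div_lt hη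
      obtain ⟨n, hn, T, y, x, hnull, hlarge⟩ := hbad (max N n₁)
      obtain ⟨θ, hθ, hθle⟩ := hq.exists_norm_add_le hm (Y + Z) ((w J : ℂ) • (y + x))
      have hc : ‖θ * (w J : ℂ)‖ = w J := by
        rw [norm_mul, hθ, one_mul, Complex.norm_real, Real.norm_of_nonneg (w.nonneg J)]
      have hTN : ∀ i ∈ T, N ≤ i := fun i hi =>
        ((le_max_left _ _).trans hn).trans (hnull.le_of_mem i hi)
      have hxc : ∀ i, ‖((θ * (w J : ℂ)) • x).seq i‖ ≤ ‖x.seq i‖ := fun i => by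
        rw [seq_smul, norm_mul, hc]
        exact mul_le_of_le_one_left (norm_nonneg _) (w.le_one J)
      refine ⟨max N (T.sup id + 1), Y + (θ * (w J : ℂ)) • y, Z + (θ * (w J : ℂ)) • x,
        fun i hi => ?_, sum_norm_add_smul_le hB.le hYN hY hnull.card_le hTN hnull.seq_eq_zero
          hnull.norm_seq_le hc.le, ?_, ?_⟩
      · have hiT : i ∉ T := fun hiT => by
          have := Finset.le_sup (f := id) hiT
          simp only [id] at this
          have := (le_max_right _ _).trans hi
          omega
        rw [seq_add, seq_smul, hYN i ((le_max_left _ _).trans hi), hnull.seq_eq_zero i hiT]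
        simp
      · have h1 := hadd ((θ * (w J : ℂ)) • x) ((norm_mono hxc).trans hnull.norm_le)
          (fun i => (hxc i).trans ((hnull.small i).trans (le_trans ?_ hn₁.le)))
        · linarith
        · have : (n₁ : ℝ) ≤ n := by exact_mod_cast (le_max_right _ _).trans hn
          gcongr
      · have h1 : Y + (θ * (w J : ℂ)) • y + (Z + (θ * (w J : ℂ)) • x)
            = Y + Z + θ • (w J : ℂ) • (y + x) := by
          rw [smul_smul, smul_add]; abel
        rw [h1, Finset.sum_range_succ, mul_add]
        refine le_trans ?_ hθle
        rw [hq.hom, norm_mul, norm_pow, Complex.norm_real, Real.norm_of_nonneg (w.nonneg J)]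
        have h2 := mul_le_mul_of_nonneg_left hlarge (pow_nonneg (w.nonneg J) m)
        linarith
  obtain ⟨C, hC, hqC⟩ := hq.exists_norm_le (K * B + 2 * B)
  refine hw (summable_of_sum_range_le (c := C / ε) (fun i => pow_nonneg (w.nonneg i) _)
    fun J => ?_)
  obtain ⟨N, Y, Z, -, hY, hZ, hle⟩ := claim J
  rw [le_div_iff₀ hε, mul_comm]
  refine hle.trans (hqC _ ((_root_.norm_add_le _ _).trans (add_le_add ?_ hZ.le)))
  refine norm_le_iff.mpr fun A => (hY A).trans ?_
  exact mul_le_mul_of_nonneg_left (w.partialSum_mono (min_le_right _ _)) (by positivity)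

theorem eventually_norm_lt {m : ℕ} (hm : 1 ≤ m) {q : LorentzPredual w → ℂ}
    (hq : HomEntire m q) (hw : ¬ Summable fun i => w i ^ m) (K : ℕ) {B ε : ℝ} (hB : 0 < B)
    (hε : 0 < ε) :
    ∀ᶠ n in atTop, ∀ T y x, NearlyNull K B n T y x → ‖q (y + x)‖ < ε := by
  by_contra hcon
  rw [eventually_atTop] at hcon
  push Not at hcon
  exact not_forall_exists_nearlyNull hm hq hw K hB hε fun n₀ => by
    obtain ⟨n, hn, T, y, x, h1, h2⟩ := hcon n₀
    exact ⟨n, hn, T, y, x, h1, h2⟩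

/-- Each Taylor term at `u` of positive degree is small by `eventually_norm_lt`, and the tail of the
expansion is uniformly small. -/
theorem eventually_norm_sub_lt {d : ℕ} {P : LorentzPredual w → ℂ} (hP : HomEntire d P)
    (hw : ∀ m : ℕ, 1 ≤ m → ¬ Summable fun i => w i ^ m) (u : LorentzPredual w) (K : ℕ)
    {B ε : ℝ} (hB : 0 < B) (hε : 0 < ε) :
    ∀ᶠ n in atTop, ∀ T y x, NearlyNull K B n T y x → ‖P (u + (y + x)) - P u‖ < ε := by
  set r := K * B + B with hr
  have hr0 : 0 < r := by positivity
  obtain ⟨C, hC, hPC⟩ := hP.exists_norm_le (‖u‖ + 2 * r)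
  -- Nearly null vectors have norm at most `r`; the doubled radius gives a geometric tail of ratio
  -- `1 / 2`.
  have hF := hP.lineHolomorphic_add (by positivity : 0 < 2 * r) u hPC
  set F : LorentzPredual w → ℂ := fun x => P (u + x) with hFdef
  obtain ⟨L, hL⟩ : ∃ L : ℕ, C * (1 / 2) ^ (L + 1) * (1 - 1 / 2)⁻¹ < ε / 2 := by
    have h1 : Tendsto (fun L : ℕ => C * (1 / 2 : ℝ) ^ (L + 1) * (1 - 1 / 2)⁻¹) atTop
        (𝓝 (C * 0 * (1 - 1 / 2)⁻¹)) :=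
      (((tendsto_pow_atTop_nhds_zero_of_lt_one (by norm_num) (by norm_num)).comp
        (tendsto_add_atTop_nat 1)).const_mul C).mul_const _
    rw [mul_zero, zero_mul] at h1
    exact (h1.eventually_lt_const (half_pos hε)).exists
  have hev : ∀ᶠ n in atTop, ∀ j ∈ Finset.range L, ∀ T y x, NearlyNull K B n T y x →
      ‖taylorTerm F (j + 1) (y + x)‖ < ε / (2 * (L + 1)) := by
    rw [eventually_all_finset]
    intro j _
    exact eventually_norm_lt (by omega) (hF.homEntire_taylorTerm _) (hw _ (by omega)) K hB
      (by positivity)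
  filter_upwards [hev] with n hn T y x hnull
  have h1 := hF.norm_sub_sum_le (ρ := 1 / 2) (by norm_num) (by norm_num) (x := y + x)
    (hnull.norm_add_le.trans (by rw [← hr]; linarith)) (L + 1)
  rw [Finset.sum_range_succ'] at h1
  have h0 : taylorTerm F 0 (y + x) = P u := by simp [taylorTerm, hFdef]
  have h2 : ‖∑ j ∈ Finset.range L, taylorTerm F (j + 1) (y + x)‖ ≤ ε / 2 := by
    refine (norm_sum_le _ _).trans ((Finset.sum_le_card_nsmul _ _ (ε / (2 * (L + 1)))
      fun j hj => (hn j hj T y x hnull).le).trans ?_)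
    rw [Finset.card_range, nsmul_eq_mul, ← mul_div_assoc, div_le_div_iff₀ (by positivity)
      (by positivity)]
    nlinarith
  have h3 : P (u + (y + x)) - P u
      = (F (y + x) - (∑ j ∈ Finset.range L, taylorTerm F (j + 1) (y + x)
        + taylorTerm F 0 (y + x))) + ∑ j ∈ Finset.range L, taylorTerm F (j + 1) (y + x) := by
    rw [h0]; simp only [hFdef]; ring
  rw [h3]
  refine (_root_.norm_add_le _ _).trans_lt ?_
  linarith

/-! ### Truncation of homogeneous polynomials. -/

theorem exists_finset_coe_eq {S : Set ℕ} {K : ℕ}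
    (h : ∀ A : Finset ℕ, (A : Set ℕ) ⊆ S → A.card ≤ K) :
    ∃ T : Finset ℕ, (∀ i, i ∈ T ↔ i ∈ S) ∧ T.card ≤ K := by
  have hfin : S.Finite := by
    by_contra hinf
    obtain ⟨A, hA, hcard⟩ := Set.Infinite.exists_subset_card_eq hinf (K + 1)
    have := h A hA
    omega
  refine ⟨hfin.toFinset, fun i => hfin.mem_toFinset, h _ (by simp)⟩

/-- Convergence of `P` along sums of vectors with at most `K` coordinates, converging
coordinatewise, and of vectors that tend to zero uniformly on coordinates. -/
theorem eventually_norm_sub_lt_of_tendsto {d : ℕ} {P : LorentzPredual w → ℂ} (hP : HomEntire d P)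
    (hw : ∀ m : ℕ, 1 ≤ m → ¬ Summable fun i => w i ^ m) {K : ℕ} {T : ℕ → Finset ℕ}
    {z r : ℕ → LorentzPredual w} {U : Finset ℕ} {u : LorentzPredual w}
    (hT : ∀ j, (T j).card ≤ K) (hz : ∀ j, ∀ i ∉ T j, (z j).seq i = 0) (hz1 : ∀ j, ‖z j‖ ≤ 1)
    (hU : U.card ≤ K) (hu : ∀ i ∉ U, u.seq i = 0)
    (hzu : ∀ i, Tendsto (fun j => (z j).seq i) atTop (𝓝 (u.seq i))) (hr1 : ∀ j, ‖r j‖ ≤ 1)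
    (hr : ∀ δ : ℝ, 0 < δ → ∀ᶠ j in atTop, ∀ i, ‖(r j).seq i‖ ≤ δ) {ε : ℝ} (hε : 0 < ε) :
    ∀ᶠ j in atTop, ‖P (z j + r j) - P u‖ < ε := by
  have hB : 0 < ‖u‖ + 2 := by positivity
  obtain ⟨n, hn⟩ := (eventually_norm_sub_lt hP hw u (K + K) hB hε).exists
  set δ : ℝ := 1 / (2 * (n + 1)) with hδ
  have hδ0 : 0 < δ := by positivity
  have h1 : ∀ᶠ j in atTop, ∀ i ∈ Finset.range n, ‖(z j).seq i - u.seq i‖ < δ := by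
    rw [eventually_all_finset]
    intro i _
    have := (tendsto_iff_norm_sub_tendsto_zero.mp (hzu i))
    exact this.eventually_lt_const hδ0
  filter_upwards [h1, hr δ hδ0] with j hj1 hj2
  have hnorm : ‖z j - u‖ ≤ ‖u‖ + 1 := (norm_sub_le _ _).trans (by linarith [hz1 j])
  -- The difference `z j - u` is cut at `n`: beyond `n` it has at most `2 * K` coordinates, below
  -- `n` it is small by coordinatewise convergence and joins `r j`.
  have hnull : NearlyNull (K + K) (‖u‖ + 2) n ((T j ∪ U).filter fun i => n ≤ i)
      (restrict (Set.Ici n) (z j - u)) (restrict (Set.Iio n) (z j - u) + r j) := by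
    refine ⟨?_, fun i hi => (Finset.mem_filter.mp hi).2, fun i hi => ?_, fun i => ?_, ?_,
      fun i => ?_⟩
    · exact (Finset.card_filter_le _ _).trans ((Finset.card_union_le _ _).trans
        (add_le_add (hT j) hU))
    · rw [seq_restrict]
      by_cases hin : i ∈ Set.Ici n
      · have hi2 : i ∉ T j ∪ U := fun h => hi (Finset.mem_filter.mpr ⟨h, hin⟩)
        rw [Finset.mem_union, not_or] at hi2
        rw [Set.indicator_of_mem hin, seq_sub, hz j i hi2.1, hu i hi2.2, sub_zero]
      · exact Set.indicator_of_notMem hin _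
    · refine (LorentzPredual.norm_seq_le _ i).trans ((norm_restrict_le _ _).trans ?_)
      linarith
    · refine (_root_.norm_add_le _ _).trans ?_
      have := norm_restrict_le (Set.Iio n) (z j - u)
      linarith [hr1 j]
    · have e : (1 : ℝ) / (n + 1) = δ + δ := by rw [hδ]; field_simp; norm_num
      rw [e, seq_add]
      refine (_root_.norm_add_le _ _).trans (add_le_add ?_ (hj2 i))
      rw [seq_restrict]
      by_cases hin : i ∈ Set.Iio n
      · rw [Set.indicator_of_mem hin, seq_sub]
        exact (hj1 i (Finset.mem_range.mpr hin)).le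
      · rw [Set.indicator_of_notMem hin, norm_zero]
        exact hδ0.le
  have h2 := hn _ _ _ hnull
  have h3 : u + (restrict (Set.Ici n) (z j - u) + (restrict (Set.Iio n) (z j - u) + r j))
      = z j + r j := by
    refine ext_seq fun i => ?_
    simp only [seq_add, seq_restrict]
    by_cases hin : n ≤ i
    · rw [Set.indicator_of_mem (show i ∈ Set.Ici n from hin),
        Set.indicator_of_notMem (show i ∉ Set.Iio n from not_lt.mpr hin), seq_sub]
      ring
    · rw [Set.indicator_of_notMem (show i ∉ Set.Ici n from hin),
        Set.indicator_of_mem (show i ∈ Set.Iio n from not_le.mp hin), seq_sub]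
      ring
  rwa [h3] at h2

/-- Truncation hardly changes `P` on vectors with at most `K` large coordinates. -/
theorem exists_norm_sub_restrict_lt {d : ℕ} {P : LorentzPredual w → ℂ} (hP : HomEntire d P)
    (hw : ∀ m : ℕ, 1 ≤ m → ¬ Summable fun i => w i ^ m) (K : ℕ) {ε : ℝ} (hε : 0 < ε) :
    ∃ n : ℕ, ∀ N ≥ n, ∀ (T : Finset ℕ) (y x : LorentzPredual w), T.card ≤ K →
      (∀ i ∉ T, y.seq i = 0) → ‖y‖ ≤ 1 → ‖x‖ ≤ 1 → (∀ i, ‖x.seq i‖ ≤ 1 / (n + 1)) →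
      ‖P (y + x) - P (restrict (Set.Iio N) (y + x))‖ < ε := by
  by_contra! hcon
  choose N hN T y x hT hy hy1 hx1 hx hbad using hcon
  -- By Tychonoff a subsequence of the `y n` converges coordinatewise; the limit again has at most
  -- `K` nonzero coordinates.
  have hcpt : IsCompact (Set.univ.pi fun _ : ℕ => closedBall (0 : ℂ) 1) :=
    isCompact_univ_pi fun _ => isCompact_closedBall _ _
  obtain ⟨u₀, -, φ, hφ, hlim⟩ := hcpt.tendsto_subseq (x := fun n => (y n).seq) (fun n i _ => by
    rw [mem_closedBall_zero_iff]
    exact ((y n).norm_seq_le i).trans (hy1 n))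
  rw [tendsto_pi_nhds] at hlim
  obtain ⟨U, hU, hUcard⟩ := exists_finset_coe_eq (S := {i | u₀ i ≠ 0}) (K := K) (fun A hA => by
    have : ∀ᶠ j in atTop, ∀ i ∈ A, (y (φ j)).seq i ≠ 0 := by
      rw [eventually_all_finset]
      exact fun i hi => (hlim i).eventually_ne (hA hi)
    obtain ⟨j, hj⟩ := this.exists
    refine (Finset.card_le_card fun i hi => ?_).trans (hT (φ j))
    by_contra hiT
    exact hj i hi (hy _ i hiT))
  set u := ofFinset w U u₀ with hu
  have hseq : ∀ i, u.seq i = u₀ i := fun i => by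
    rw [hu, seq_ofFinset]
    split_ifs with h
    · rfl
    · by_contra h0
      exact h ((hU i).mpr (Ne.symm h0))
  have huU : ∀ i ∉ U, u.seq i = 0 := fun i hi => by rw [hu, seq_ofFinset, if_neg hi]
  have hsmall : ∀ δ : ℝ, 0 < δ → ∀ᶠ j in atTop, ∀ i, ‖(x (φ j)).seq i‖ ≤ δ := by
    intro δ hδ
    have : Tendsto (fun j => 1 / ((φ j : ℝ) + 1)) atTop (𝓝 0) :=
      tendsto_one_div_add_atTop_nhds_zero_nat.comp hφ.tendsto_atTop
    filter_upwards [this.eventually_lt_const hδ] with j hj i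
    exact (hx _ i).trans hj.le
  have h1 := eventually_norm_sub_lt_of_tendsto hP hw (T := fun j => T (φ j))
    (z := fun j => y (φ j)) (r := fun j => x (φ j)) (fun j => hT _) (fun j => hy _)
    (fun j => hy1 _) hUcard huU (fun i => (hseq i).symm ▸ hlim i) (fun j => hx1 _) hsmall
    (half_pos hε)
  -- The truncated vectors have the same coordinatewise limit because the cut-offs tend to infinity,
  -- so both values of `P` approach `P u`.
  have h2 := eventually_norm_sub_lt_of_tendsto hP hw (T := fun j => T (φ j))
    (z := fun j => restrict (Set.Iio (N (φ j))) (y (φ j)))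
    (r := fun j => restrict (Set.Iio (N (φ j))) (x (φ j))) (u := u) (fun j => hT _)
    (fun j i hi => by
      rw [seq_restrict, ← norm_le_zero_iff]
      exact (norm_indicator_le _ _ i).trans (by rw [hy _ i hi, norm_zero]))
    (fun j => (norm_restrict_le _ _).trans (hy1 _)) hUcard huU
    (fun i => by
      rw [hseq]
      refine (hlim i).congr' ?_
      filter_upwards [hφ.tendsto_atTop.eventually_gt_atTop i] with j hj
      rw [seq_restrict, Set.indicator_of_mem (show i ∈ Set.Iio (N (φ j)) from
        hj.trans_le (hN (φ j)))]
      rfl)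
    (fun j => (norm_restrict_le _ _).trans (hx1 _))
    (fun δ hδ => by
      filter_upwards [hsmall δ hδ] with j hj i
      exact (norm_indicator_le _ _ i).trans (hj i))
    (half_pos hε)
  obtain ⟨j, hj1, hj2⟩ := (h1.and h2).exists
  have h3 := hbad (φ j)
  rw [map_add] at h3
  rw [norm_sub_rev] at hj2
  have h4 := norm_sub_le_norm_sub_add_norm_sub (P (y (φ j) + x (φ j))) (P u)
    (P (restrict (Set.Iio (N (φ j))) (y (φ j)) + restrict (Set.Iio (N (φ j))) (x (φ j))))
  linarith

/-- The changes of `P` caused by deleting disjoint parts of a vector are summable. -/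
theorem exists_sum_norm_sub_restrict_le {d : ℕ} {P : LorentzPredual w → ℂ}
    (hP : HomEntire d P) : ∃ C : ℝ, ∀ x : LorentzPredual w, ‖x‖ ≤ 1 → ∀ (M : ℕ) (E : ℕ → Set ℕ),
      Pairwise (fun r s => Disjoint (E r) (E s)) →
      ∑ r ∈ Finset.range M, ‖P (x - restrict (E r) x) - P x‖ ≤ C := by
  obtain ⟨C, hC, hPC⟩ := hP.exists_norm_le 3
  refine ⟨3 * C, fun x hx M E hE => ?_⟩
  have hF := hP.lineHolomorphic_add two_pos x (C := C) fun y hy => hPC y (by linarith)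
  set F : LorentzPredual w → ℂ := fun y => P (x + y) with hFdef
  set v : ℕ → LorentzPredual w := fun r => -restrict (E r) x with hv
  -- The pieces are disjoint, so the sum is dominated coordinatewise by `x` for any phases. Phases
  -- making the values of a Taylor term add up then bound the sum of their moduli independently of
  -- `M`.
  have hsum : ∀ θ : ℕ → ℂ, (∀ r, ‖θ r‖ = 1) → ‖∑ r ∈ Finset.range M, θ r • v r‖ ≤ 1 := by
    intro θ hθ
    refine (norm_mono fun i => ?_).trans hx
    rw [seq_sum]
    have hvi : ∀ r, (v r).seq i = -(E r).indicator x.seq i := fun r => rfl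
    by_cases hi : ∃ r ∈ Finset.range M, i ∈ E r
    · obtain ⟨r, hr, hir⟩ := hi
      rw [Finset.sum_eq_single_of_mem r hr]
      · rw [seq_smul, hvi, norm_mul, hθ, one_mul, norm_neg]
        exact norm_indicator_le _ _ i
      · intro s _ hsr
        rw [seq_smul, hvi, Set.indicator_of_notMem, neg_zero, mul_zero]
        exact fun his => Set.disjoint_left.mp (hE hsr) his hir
    · push Not at hi
      rw [Finset.sum_eq_zero, norm_zero]
      · exact norm_nonneg _
      · intro s hs
        rw [seq_smul, hvi, Set.indicator_of_notMem (hi s hs), neg_zero, mul_zero]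
  have hterm : ∀ l : ℕ, ∑ r ∈ Finset.range M, ‖taylorTerm F (l + 1) (v r)‖
      ≤ C * (1 / 2) ^ (l + 1) := by
    intro l
    obtain ⟨θ, hθ, hle⟩ := (hF.homEntire_taylorTerm (l + 1)).exists_sum_norm_le (by omega)
      (Finset.range M) v
    refine hle.trans ((hF.norm_taylorTerm_le _ _).trans ?_)
    have := hsum θ hθ
    gcongr
  have hv1 : ∀ r, ‖v r‖ ≤ 1 / 2 * 2 := fun r => by
    rw [hv, norm_neg]
    exact (norm_restrict_le _ _).trans (by linarith)
  -- The order `L` may depend on `M`: it only makes the `M` remainders cost at most `C` together.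
  obtain ⟨L, hL⟩ : ∃ L : ℕ, (M : ℝ) * (1 / 2) ^ L ≤ 1 := by
    refine ⟨M, ?_⟩
    rw [one_div, inv_pow, ← div_eq_mul_inv, div_le_one (by positivity)]
    exact_mod_cast Nat.lt_two_pow_self.le
  have h0 : ∀ r, taylorTerm F 0 (v r) = P x := fun r => by simp [taylorTerm, hFdef]
  have hr : ∀ r ∈ Finset.range M, ‖P (x - restrict (E r) x) - P x‖
      ≤ C * (1 / 2) ^ L + ∑ l ∈ Finset.range L, ‖taylorTerm F (l + 1) (v r)‖ := by
    intro r _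
    have h1 := hF.norm_sub_sum_le (ρ := 1 / 2) (by norm_num) (by norm_num) (hv1 r) (L + 1)
    rw [Finset.sum_range_succ', h0] at h1
    have h2 : P (x - restrict (E r) x) - P x
        = (F (v r) - (∑ l ∈ Finset.range L, taylorTerm F (l + 1) (v r) + P x))
          + ∑ l ∈ Finset.range L, taylorTerm F (l + 1) (v r) := by
      simp only [hFdef, hv, ← sub_eq_add_neg]
      ring
    rw [h2]
    refine (_root_.norm_add_le _ _).trans (add_le_add (h1.trans (le_of_eq ?_))
      (norm_sum_le _ _))
    rw [pow_succ]; norm_num; ring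
  refine (Finset.sum_le_sum hr).trans ?_
  rw [Finset.sum_add_distrib, Finset.sum_comm, Finset.sum_const, Finset.card_range, nsmul_eq_mul]
  have h3 : ∑ l ∈ Finset.range L, ∑ r ∈ Finset.range M, ‖taylorTerm F (l + 1) (v r)‖ ≤ C * 2 := by
    refine (Finset.sum_le_sum fun l _ => hterm l).trans ?_
    rw [← Finset.mul_sum]
    refine mul_le_mul_of_nonneg_left ?_ hC
    have h4 : ∀ l ∈ Finset.range L, (1 / 2 : ℝ) ^ (l + 1) ≤ (1 / 2) ^ l := fun l _ =>
      pow_le_pow_of_le_one (by norm_num) (by norm_num) (Nat.le_succ l)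
    exact (Finset.sum_le_sum h4).trans
      (sum_le_hasSum _ (fun _ _ => by positivity) hasSum_geometric_two)
  have h4 := mul_le_mul_of_nonneg_left hL hC
  linarith

theorem restrict_comm (S T : Set ℕ) (x : LorentzPredual w) :
    restrict S (restrict T x) = restrict T (restrict S x) :=
  ext_seq fun i => by
    show S.indicator (T.indicator x.seq) i = T.indicator (S.indicator x.seq) i
    rw [Set.indicator_indicator, Set.indicator_indicator, Set.inter_comm]

/-- The indices of the coordinates with modulus in `(η', η]`. -/
def level (x : LorentzPredual w) (η' η : ℝ) : Set ℕ := {i | η' < ‖x.seq i‖ ∧ ‖x.seq i‖ ≤ η}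

/-- If a suitable intermediate level is deleted, then truncation hardly changes `P`. -/
theorem exists_level {d : ℕ} {P : LorentzPredual w → ℂ} (hP : HomEntire d P)
    (hw : ∀ m : ℕ, 1 ≤ m → ¬ Summable fun i => w i ^ m) {ε : ℝ} (hε : 0 < ε) {η : ℝ}
    (hη : 0 < η) : ∃ η' : ℝ, 0 < η' ∧ η' ≤ η ∧ ∃ n : ℕ, ∀ N ≥ n, ∀ x : LorentzPredual w, ‖x‖ ≤ 1 →
      ‖P (x - restrict (level x η' η) x)
        - P (restrict (Set.Iio N) (x - restrict (level x η' η) x))‖ < ε := by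
  obtain ⟨K, hK⟩ := w.exists_card_le hη
  obtain ⟨n, hn⟩ := exists_norm_sub_restrict_lt hP hw K hε
  refine ⟨min η (1 / (n + 1)), lt_min hη (by positivity), min_le_left _ _, n,
    fun N hN x hx => ?_⟩
  set η' : ℝ := min η (1 / (n + 1))
  obtain ⟨T, hT, hTcard⟩ := exists_finset_coe_eq (S := {i | η < ‖x.seq i‖}) (K := K)
    (fun A hA => hK _ (by
      have h1 : A.card • η ≤ ∑ i ∈ A, ‖x.seq i‖ :=
        Finset.card_nsmul_le_sum _ _ _ fun i hi => (hA hi).le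
      have h2 := norm_le_iff.mp hx A
      rw [nsmul_eq_mul] at h1
      linarith))
  have h1 : x - restrict (level x η' η) x
      = restrict {i | η < ‖x.seq i‖} x + restrict {i | ‖x.seq i‖ ≤ η'} x := by
    refine ext_seq fun i => ?_
    simp only [seq_sub, seq_add, seq_restrict, Set.indicator_apply, level, Set.mem_ofPred_eq]
    have hle : η' ≤ η := min_le_left _ _
    by_cases ha : η < ‖x.seq i‖
    · have hb : ¬ ‖x.seq i‖ ≤ η' := by linarith
      have hc : ¬ ‖x.seq i‖ ≤ η := by linarith
      simp [ha, hb, hc]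
    · by_cases hb : ‖x.seq i‖ ≤ η'
      · simp [ha, hb, not_lt.mpr hb]
      · simp [ha, hb, not_lt.mp ha, not_le.mp hb]
  rw [h1]
  refine hn N hN T _ _ hTcard (fun i hi => ?_) ((norm_restrict_le _ _).trans hx)
    ((norm_restrict_le _ _).trans hx) (fun i => ?_)
  · rw [seq_restrict]
    exact Set.indicator_of_notMem (fun h => hi ((hT i).mpr h)) _
  · rw [seq_restrict]
    by_cases h : ‖x.seq i‖ ≤ η'
    · rw [Set.indicator_of_mem (show i ∈ {i | ‖x.seq i‖ ≤ η'} from h)]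
      exact h.trans (min_le_right _ _)
    · rw [Set.indicator_of_notMem (show i ∉ {i | ‖x.seq i‖ ≤ η'} from h), norm_zero]
      positivity

/-- Homogeneous polynomials are uniformly approximated by their truncations. -/
theorem eventually_norm_sub_restrict_lt {d : ℕ} {P : LorentzPredual w → ℂ} (hP : HomEntire d P)
    (hw : ∀ m : ℕ, 1 ≤ m → ¬ Summable fun i => w i ^ m) {ε : ℝ} (hε : 0 < ε) :
    ∀ᶠ N in atTop, ∀ x : LorentzPredual w, ‖x‖ ≤ 1 → ‖P x - P (restrict (Set.Iio N) x)‖ < ε := by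
  obtain ⟨C, hC⟩ := exists_sum_norm_sub_restrict_le hP
  choose g hg0 hgle n hn using fun (η : {η : ℝ // 0 < η}) =>
    exists_level hP hw (half_pos hε) η.2
  -- Consecutive thresholds from `exists_level`, chosen independently of `x`; the levels between
  -- them are disjoint.
  set η : ℕ → {η : ℝ // 0 < η} := fun r => Nat.rec ⟨1, one_pos⟩ (fun _ η => ⟨g η, hg0 η⟩) r with hη
  have hsucc : ∀ r, (η (r + 1) : ℝ) = g (η r) := fun r => rfl
  have hanti : Antitone fun r => (η r : ℝ) := antitone_nat_of_succ_le fun r => by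
    rw [hsucc]; exact hgle _
  obtain ⟨M, hM⟩ := exists_nat_gt (2 * C / (ε / 2))
  rw [div_lt_iff₀ (half_pos hε)] at hM
  have hev : ∀ᶠ N in atTop, ∀ r ∈ Finset.range M, n (η r) ≤ N := by
    rw [eventually_all_finset]
    exact fun r _ => eventually_ge_atTop _
  filter_upwards [hev] with N hN x hx
  set E : ℕ → Set ℕ := fun r => level x (η (r + 1)) (η r) with hE
  have hdisj : Pairwise fun r s => Disjoint (E r) (E s) := by
    have key : ∀ r s, r < s → Disjoint (E r) (E s) := fun r s hrs =>
      Set.disjoint_left.mpr fun i hi hi' => by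
        have h1 : (η s : ℝ) ≤ η (r + 1) := hanti (Nat.succ_le_of_lt hrs)
        have h2 := hi.1
        have h3 := hi'.2
        linarith
    intro r s hrs
    rcases lt_or_gt_of_ne hrs with h | h
    · exact key r s h
    · exact (key s r h).symm
  have hx' : ‖restrict (Set.Iio N) x‖ ≤ 1 := (norm_restrict_le _ _).trans hx
  have h1 := hC x hx M E hdisj
  have h2 := hC _ hx' M E hdisj
  -- Pigeonhole: the costs for `x` and for its truncation sum to at most `2 * C < M * (ε / 2)`. The
  -- levels of `x` serve for both, since restrictions commute.
  have h3 : ∃ r ∈ Finset.range M, ‖P (x - restrict (E r) x) - P x‖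
      + ‖P (restrict (Set.Iio N) x - restrict (E r) (restrict (Set.Iio N) x))
        - P (restrict (Set.Iio N) x)‖ < ε / 2 := by
    by_contra! hcon
    have h4 := Finset.card_nsmul_le_sum _ _ _ hcon
    rw [Finset.card_range, nsmul_eq_mul, Finset.sum_add_distrib] at h4
    linarith
  obtain ⟨r, hr, hlt⟩ := h3
  have h5 := hn (η r) N (hN r hr) x hx
  rw [map_sub, restrict_comm (Set.Iio N)] at h5
  rw [← hsucc] at h5
  set a := P (x - restrict (E r) x)
  set b := P (restrict (Set.Iio N) x - restrict (E r) (restrict (Set.Iio N) x))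
  have h6 : P x - P (restrict (Set.Iio N) x)
      = -(a - P x) + ((a - b) + (b - P (restrict (Set.Iio N) x))) := by ring
  rw [h6]
  refine (_root_.norm_add_le _ _).trans_lt ?_
  have h7 := _root_.norm_add_le (a - b) (b - P (restrict (Set.Iio N) x))
  rw [norm_neg]
  linarith

end LorentzPredual

/-! ### Approximation by truncations and attainment in `A_u`. -/

namespace LorentzPredual

variable {w : AdmissibleSeq}

/-- The truncation of an element of the closed unit ball. -/
def truncBall (n : ℕ) (x : closedBall (0 : LorentzPredual w) 1) :
    closedBall (0 : LorentzPredual w) 1 :=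
  ⟨restrict (Set.Iio n) x.1, mem_closedBall_zero_iff.mpr
    ((norm_restrict_le _ _).trans (mem_closedBall_zero_iff.mp x.2))⟩

theorem lineHolomorphic_of_differentiableOn {X : Type*} [NormedAddCommGroup X] [NormedSpace ℂ X]
    {F : X → ℂ} {C : ℝ} (hF : DifferentiableOn ℂ F (ball 0 1)) (hC : ∀ x, ‖x‖ < 1 → ‖F x‖ ≤ C) :
    LineHolomorphic 1 C F where
  pos := one_pos
  cont := hF.continuousOn
  bound := hC
  line a b := hF.comp (by fun_prop) fun t ht => mem_ball_zero_iff.mpr ht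

/-- Functions in `A_u` are uniformly approximated by their truncations. -/
theorem eventually_norm_sub_truncBall_le
    (hw : ∀ m : ℕ, 1 ≤ m → ¬ Summable fun i => w i ^ m) (f : BallAlgebra (LorentzPredual w))
    {ε : ℝ} (hε : 0 < ε) :
    ∀ᶠ n in atTop, ∀ x : closedBall (0 : LorentzPredual w) 1,
      ‖f.1 x - f.1 (truncBall n x)‖ ≤ ε := by
  obtain ⟨hu, F, hFf, hFd⟩ := f.2
  have hF : LineHolomorphic 1 ‖f.1‖ F := lineHolomorphic_of_differentiableOn hFd fun x hx => by
    rw [hFf ⟨x, mem_closedBall_zero_iff.mpr hx.le⟩]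
    exact f.1.norm_coe_le_norm _
  -- Five errors occur: a dilation and a Taylor tail for each of `x` and its truncation, and the
  -- truncation of the Taylor polynomial.
  obtain ⟨δ, hδ, hfδ⟩ := Metric.uniformContinuous_iff.mp hu (ε / 5) (by positivity)
  obtain ⟨ρ, hρ0, hρ1, hρδ⟩ : ∃ ρ : ℝ, 0 ≤ ρ ∧ ρ < 1 ∧ 1 - ρ < δ :=
    ⟨max 0 (1 - δ / 2), le_max_left _ _, max_lt one_pos (by linarith),
      by linarith [le_max_right 0 (1 - δ / 2)]⟩
  have hnorm : ∀ x : LorentzPredual w, ‖(ρ : ℂ) • x‖ = ρ * ‖x‖ := fun x => by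
    rw [norm_smul, Complex.norm_real, Real.norm_of_nonneg hρ0]
  have hscale : ∀ x : closedBall (0 : LorentzPredual w) 1, ‖f.1 x - F ((ρ : ℂ) • x.1)‖ < ε / 5 := by
    intro x
    have hx := mem_closedBall_zero_iff.mp x.2
    have hmem : (ρ : ℂ) • x.1 ∈ closedBall (0 : LorentzPredual w) 1 := by
      rw [mem_closedBall_zero_iff, hnorm]
      exact mul_le_one₀ hρ1.le (norm_nonneg _) hx
    rw [hFf ⟨_, hmem⟩, ← dist_eq_norm]
    refine hfδ ?_
    rw [Subtype.dist_eq, dist_eq_norm]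
    have e : x.1 - (ρ : ℂ) • x.1 = ((1 - ρ : ℝ) : ℂ) • x.1 := by
      push_cast
      rw [sub_smul, one_smul]
    rw [e, norm_smul, Complex.norm_real, Real.norm_of_nonneg (by linarith)]
    exact (mul_le_of_le_one_right (by linarith) hx).trans_lt hρδ
  obtain ⟨L, hL⟩ : ∃ L : ℕ, ‖f.1‖ * ρ ^ L * (1 - ρ)⁻¹ < ε / 5 := by
    have h1 : Tendsto (fun L : ℕ => ‖f.1‖ * ρ ^ L * (1 - ρ)⁻¹) atTop
        (𝓝 (‖f.1‖ * 0 * (1 - ρ)⁻¹)) :=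
      ((tendsto_pow_atTop_nhds_zero_of_lt_one hρ0 hρ1).const_mul _).mul_const _
    rw [mul_zero, zero_mul] at h1
    exact (h1.eventually_lt_const (by positivity)).exists
  have htail : ∀ x : closedBall (0 : LorentzPredual w) 1,
      ‖F ((ρ : ℂ) • x.1) - ∑ j ∈ Finset.range L, taylorTerm F j ((ρ : ℂ) • x.1)‖ ≤ ε / 5 := by
    intro x
    refine (hF.norm_sub_sum_le hρ0 hρ1 ?_ L).trans hL.le
    rw [hnorm]
    gcongr
    exact mem_closedBall_zero_iff.mp x.2
  have hev : ∀ᶠ n in atTop, ∀ j ∈ Finset.range L, ∀ x : LorentzPredual w, ‖x‖ ≤ 1 →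
      ‖taylorTerm F j x - taylorTerm F j (restrict (Set.Iio n) x)‖ < ε / (5 * (L + 1)) := by
    rw [eventually_all_finset]
    exact fun j _ => eventually_norm_sub_restrict_lt (hF.homEntire_taylorTerm j) hw
      (by positivity)
  filter_upwards [hev] with n hn x
  have h1 := hscale x
  have h2 := hscale (truncBall n x)
  have h3 := htail x
  have h4 := htail (truncBall n x)
  have h5 : ‖∑ j ∈ Finset.range L, taylorTerm F j ((ρ : ℂ) • x.1)
      - ∑ j ∈ Finset.range L, taylorTerm F j ((ρ : ℂ) • (truncBall n x).1)‖ ≤ ε / 5 := by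
    have h6 : ‖(ρ : ℂ) • x.1‖ ≤ 1 := by
      rw [hnorm]
      exact mul_le_one₀ hρ1.le (norm_nonneg _) (mem_closedBall_zero_iff.mp x.2)
    have h7 : (ρ : ℂ) • (truncBall n x).1 = restrict (Set.Iio n) ((ρ : ℂ) • x.1) :=
      (map_smul _ _ _).symm
    rw [h7, ← Finset.sum_sub_distrib]
    refine (norm_sum_le _ _).trans ((Finset.sum_le_card_nsmul _ _ (ε / (5 * (L + 1)))
      fun j hj => (hn j hj _ h6).le).trans ?_)
    rw [Finset.card_range, nsmul_eq_mul, ← mul_div_assoc, div_le_div_iff₀ (by positivity)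
      (by positivity)]
    nlinarith
  rw [← dist_eq_norm] at h1 h2 h3 h4 h5 ⊢
  have t1 := dist_triangle4 (f.1 x) (F ((ρ : ℂ) • x.1))
    (∑ j ∈ Finset.range L, taylorTerm F j ((ρ : ℂ) • x.1))
    (∑ j ∈ Finset.range L, taylorTerm F j ((ρ : ℂ) • (truncBall n x).1))
  have t2 := dist_triangle4 (f.1 x)
    (∑ j ∈ Finset.range L, taylorTerm F j ((ρ : ℂ) • (truncBall n x).1))
    (F ((ρ : ℂ) • (truncBall n x).1)) (f.1 (truncBall n x))
  rw [dist_comm _ (F ((ρ : ℂ) • (truncBall n x).1)),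
    dist_comm (F ((ρ : ℂ) • (truncBall n x).1)) (f.1 (truncBall n x))] at t2
  linarith

/-- The composition of an element of `A_u` with a truncation. -/
theorem exists_compTrunc (f : BallAlgebra (LorentzPredual w)) (n : ℕ) :
    ∃ h : BallAlgebra (LorentzPredual w), ∀ x, h.1 x = f.1 (truncBall n x) := by
  obtain ⟨hu, F, hFf, hFd⟩ := f.2
  refine ⟨BallAlgebra.ofFun (fun x => F (restrict (Set.Iio n) x)) ‖f.1‖ (fun x hx => ?_) ?_ ?_,
    fun x => hFf (truncBall n x)⟩
  · have h1 := hFf (truncBall n ⟨x, mem_closedBall_zero_iff.mpr hx⟩)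
    exact (congrArg norm h1).trans_le (f.1.norm_coe_le_norm _)
  · have h1 : UniformContinuous (truncBall (w := w) n) :=
      ((restrict (Set.Iio n)).uniformContinuous.comp uniformContinuous_subtype_val).subtype_mk _
    exact (funext fun x => hFf (truncBall n x) :
      (fun x : closedBall (0 : LorentzPredual w) 1 => F (restrict (Set.Iio n) x.1)) = _) ▸
        hu.comp h1
  · refine hFd.comp (restrict (Set.Iio n)).differentiable.differentiableOn fun x hx => ?_
    rw [mem_ball_zero_iff] at hx ⊢
    exact (norm_restrict_le _ _).trans_lt hx

/-- Functions that factor through a truncation attain their `‖·‖_s`-norm. -/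
theorem attainsNormOn_of_trunc {s : ℝ} (hs0 : 0 < s) (hs1 : s < 1)
    {f h : BallAlgebra (LorentzPredual w)} {n : ℕ} (hfh : ∀ x, h.1 x = f.1 (truncBall n x)) :
    BallAlgebra.AttainsNormOn s h := by
  obtain ⟨-, F, hFf, hFd⟩ := f.2
  -- Parametrizes the range of the truncation; the part of norm at most `s` becomes a compact set,
  -- and since `s < 1` the function is continuous there.
  set Φ : (Fin n → ℂ) → LorentzPredual w := fun a => ∑ i, a i • ofFinset w {i.1} 1 with hΦ
  have hΦc : Continuous Φ := by fun_prop
  have hseq : ∀ (a : Fin n → ℂ) (k : ℕ), (Φ a).seq k = if hk : k < n then a ⟨k, hk⟩ else 0 := by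
    intro a k
    rw [hΦ, seq_sum]
    simp only [seq_smul, seq_ofFinset, Finset.mem_singleton, Pi.one_apply, mul_ite, mul_one,
      mul_zero]
    split_ifs with hk
    · rw [Finset.sum_eq_single ⟨k, hk⟩]
      · simp
      · intro i _ hi
        rw [if_neg]
        exact fun h => hi (Fin.ext h.symm)
      · simp
    · exact Finset.sum_eq_zero fun i _ => if_neg fun (h : k = i) => hk (h ▸ i.2)
  have hrestrict : ∀ x : LorentzPredual w,
      restrict (Set.Iio n) x = Φ fun i => x.seq i := by
    refine fun x => ext_seq fun k => ?_
    rw [hseq, seq_restrict, Set.indicator_apply]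
    simp only [Set.mem_Iio, dite_eq_ite]
  set D : Set (Fin n → ℂ) := {a | ‖Φ a‖ ≤ s} with hD
  have hDcpt : IsCompact D := by
    refine Metric.isCompact_of_isClosed_isBounded
      (isClosed_le hΦc.norm continuous_const) ?_
    refine (isBounded_iff_forall_norm_le).mpr ⟨s, fun a ha => ?_⟩
    refine (pi_norm_le_iff_of_nonneg hs0.le).mpr fun i => ?_
    have h1 := ((Φ a).norm_seq_le i).trans ha
    rwa [hseq, dif_pos i.2] at h1
  have hDne : D.Nonempty := ⟨0, by simp [hD, hΦ, hs0.le]⟩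
  have hcont : ContinuousOn (fun a => ‖F (Φ a)‖) D :=
    (hFd.continuousOn.comp hΦc.continuousOn fun a ha =>
      mem_ball_zero_iff.mpr (lt_of_le_of_lt ha hs1)).norm
  obtain ⟨a, haD, hmax⟩ := hDcpt.exists_isMaxOn hDne hcont
  have haD' : ‖Φ a‖ ≤ s := haD
  have hmem : Φ a ∈ closedBall (0 : LorentzPredual w) 1 :=
    mem_closedBall_zero_iff.mpr (haD'.trans hs1.le)
  have htrunc : restrict (Set.Iio n) (Φ a) = Φ a := by
    rw [hrestrict]
    congr 1
    funext i
    rw [hseq, dif_pos i.2]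
  refine ⟨⟨Φ a, hmem⟩, haD, le_antisymm (BallAlgebra.norm_le_normOn s h _ haD) ?_⟩
  refine csSup_le ⟨_, ⟨Φ a, hmem⟩, haD, rfl⟩ ?_
  rintro _ ⟨x, hx, rfl⟩
  rw [hfh, hfh, ← hFf, ← hFf]
  show ‖F (restrict (Set.Iio n) x.1)‖ ≤ ‖F (restrict (Set.Iio n) (Φ a))‖
  rw [htrunc, hrestrict]
  refine hmax ?_
  show ‖Φ fun i => x.1.seq i‖ ≤ s
  rw [← hrestrict]
  exact (norm_restrict_le _ _).trans hx

end LorentzPredual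

/-! ### Density and the final equivalence. -/

theorem dense_attainsNormOn {w : AdmissibleSeq} {s : ℝ} (hs0 : 0 < s) (hs1 : s < 1)
    (hw : ∀ m : ℕ, 1 ≤ m → ¬ Summable fun i => w i ^ m) :
    Dense {f : BallAlgebra (LorentzPredual w) | BallAlgebra.AttainsNormOn s f} := by
  rw [Metric.dense_iff]
  intro f r hr
  obtain ⟨n, hn⟩ :=
    (LorentzPredual.eventually_norm_sub_truncBall_le hw f (half_pos hr)).exists
  obtain ⟨h, hh⟩ := LorentzPredual.exists_compTrunc f n
  refine ⟨h, ?_, LorentzPredual.attainsNormOn_of_trunc hs0 hs1 hh⟩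
  rw [mem_ball, dist_comm]
  refine lt_of_le_of_lt ?_ (half_lt_self hr)
  refine (BoundedContinuousFunction.dist_le (half_pos hr).le).mpr fun x => ?_
  rw [dist_eq_norm]
  exact (hh x).symm ▸ hn x

theorem AdmissibleSeq.memℓp_iff (w : AdmissibleSeq) {N : ℕ} (hN : 1 ≤ N) :
    Memℓp (w : ℕ → ℝ) (N : ℝ≥0∞) ↔ Summable fun i => w i ^ N := by
  rw [memℓp_gen_iff (by rw [ENNReal.toReal_natCast]; exact_mod_cast hN)]
  refine summable_congr fun i => ?_
  rw [ENNReal.toReal_natCast, Real.rpow_natCast, Real.norm_of_nonneg (w.nonneg i)]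

end

theorem mainTheorem11 (w : AdmissibleSeq) (s : ℝ) (hs0 : 0 < s) (hs1 : s < 1) :
    Dense {f : BallAlgebra (LorentzPredual w) | BallAlgebra.AttainsNormOn s f} ↔
      ∀ N : ℕ, 1 ≤ N → ¬ Memℓp (w : ℕ → ℝ) (N : ℝ≥0∞) := by
  constructor
  · intro hdense N hN hmem
    exact not_dense_attainsNormOn hs0 hs1 hN ((w.memℓp_iff hN).mp hmem) hdense
  · intro h
    exact dense_attainsNormOn hs0 hs1 fun m hm hsum => h m hm ((w.memℓp_iff hm).mpr hsum)
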